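/- Let $0<H<1$ and let $B=\{B_t,\ t\ge 0\}$ be a one-dimensional fractional Brownian motion with Hurst parameter $H$, that is, a centred Gaussian process with covariance $R_H(t,s)=\mathbb{E}(B_tB_s)=\frac12\left(s^{2H}+t^{2H}-|t-s|^{2H}\right)$. For $T>0$ let $\mathcal{H}$ be the Hilbert space obtained by completing the step functions on $[0,T]$ for the scalar product $\langle \mathbf{1}_{[0,t]},\mathbf{1}_{[0,s]}\rangle_{\mathcal H}=R_H(t,s)$, and let $\varphi\mapsto B(\varphi)$ be the linear isometry from $\mathcal H$ into $L^2(\Omega)$ with $B(\mathbf 1_{[0,t]})=B_t$. For $n\ge 0$ and $g\in\mathcal{H}^{\otimes n}$ let $I_n(g)$ denote the multiple Wiener integral of $g$ with respect to $B$, i.e. the element of $L^2(\Omega,\sigma(B_s,\,s\le T))$ determined by $\mathbb{E}(F\,I_n(g))=\mathbb{E}\langle D^nF,g\rangle_{\mathcal{H}^{\otimes n}}$ for all $F=f(B(\varphi_1),\dots,B(\varphi_m))$ with $\varphi_i\in\mathcal H$ and $f$ smooth and bounded with all its derivatives, where $D^nF=\sum_{i_1,\dots,i_n}\partial_{i_1}\cdots\partial_{i_n}f(B(\varphi_1),\dots,B(\varphi_m))\,\varphi_{i_1}\otimes\cdots\otimes\varphi_{i_n}$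 is the $n$-th Malliavin derivative. The $n$-th Wiener chaos is the set of all $I_n(g)$, $g\in\mathcal H^{\otimes n}$. Then for every $0<t\le T$ the integrals $I_n(\mathbf 1_{[0,t]}^{\otimes n})$, $n\ge0$, exist and are unique, and $$\mathrm{sign}(B_t)=\sum_{k=0}^{\infty} b_{2k+1}\,I_{2k+1}\!\left(\mathbf 1_{[0,t]}^{\otimes(2k+1)}\right),\qquad b_{2k+1}=\frac{2(-1)^k}{(2k+1)\sqrt{2\pi}\;t^{(2k+1)H}\,k!\,2^k},$$ where the series converges in $L^2(\Omega)$. In particular only chaoses of odd order appear: $\mathrm{sign}(B_t)$ is orthogonal in $L^2(\Omega)$ to every Wiener chaos of even order. -/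

import Mathlib

open MeasureTheory ProbabilityTheory
open scoped NNReal ENNReal

noncomputable section

namespace FBM

/-- The covariance function of fractional Brownian motion with Hurst parameter `H`:
`R_H(t, s) = (s^{2H} + t^{2H} - |t - s|^{2H}) / 2`. -/
def cov (H : ℝ) (t s : ℝ≥0) : ℝ :=
  ((s : ℝ) ^ (2 * H) + (t : ℝ) ^ (2 * H) - |(t : ℝ) - (s : ℝ)| ^ (2 * H)) / 2

/-- `B` is a fractional Brownian motion with Hurst parameter `H`: a centred Gaussian process
with covariance `R_H`. -/
structure IsFBM {Ω : Type*} [MeasurableSpace Ω] (H : ℝ) (B : ℝ≥0 → Ω → ℝ) (P : Measure Ω) :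
    Prop where
  measurable : ∀ t, Measurable (B t)
  gaussian : IsGaussianProcess B P
  mean_zero : ∀ t, ∫ ω, B t ω ∂P = 0
  covariance : ∀ t s, ∫ ω, B t ω * B s ω ∂P = cov H t s

variable {Ω : Type*} [MeasurableSpace Ω]

/-- The Hilbert space `𝓗` of the process on `[0, T]`: the completion of the step functions for the
scalar product `⟨1_{[0,t]}, 1_{[0,s]}⟩ = E(B_t B_s)`. It is realised through the isometry
`φ ↦ B(φ)`, as the closed linear span of `{B_s : s ∈ [0, T]}` in `L²(P)`: the function `1_{[0,s]}`
is the class of `B_s`, and an element `φ` of this space, read as a random variable, is the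
Wiener integral `B(φ)`. See `IsFBM.inner_ind` for the scalar product. -/
def hilb (B : ℝ≥0 → Ω → ℝ) (P : Measure Ω) (T : ℝ≥0) : Submodule ℝ (Lp ℝ 2 P) :=
  (Submodule.span ℝ {X : Lp ℝ 2 P | ∃ s ≤ T, X =ᵐ[P] B s}).topologicalClosure

/-- The sigma-algebra generated by `{B_s : s ∈ [0, T]}`. -/
abbrev sigmaAlg (B : ℝ≥0 → Ω → ℝ) (T : ℝ≥0) : MeasurableSpace Ω :=
  ⨆ s : Set.Iic T, MeasurableSpace.comap (B s) inferInstance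

theorem memLp_tensor (P : Measure Ω) [IsProbabilityMeasure P] {n : ℕ}
    (φ : Fin n → Lp ℝ 2 P) :
    MemLp (fun x : Fin n → Ω => ∏ j, φ j (x j)) 2 (Measure.pi fun _ : Fin n => P) := by
  rw [memLp_two_iff_integrable_sq]
  · simp_rw [← Finset.prod_pow]
    exact Integrable.fintype_prod (f := fun j ω => (φ j ω) ^ 2)
      fun j => (Lp.memLp (φ j)).integrable_sq
  · have h : ∀ j, AEStronglyMeasurable (fun x : Fin n → Ω => φ j (x j))
        (Measure.pi fun _ : Fin n => P) := fun j =>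
      (Lp.aestronglyMeasurable (φ j)).comp_quasiMeasurePreserving
        (Measure.quasiMeasurePreserving_eval _ j)
    exact Finset.aestronglyMeasurable_fun_prod _ fun j _ => h j

/-- The elementary tensor `φ₁ ⊗ ⋯ ⊗ φₙ` of elements of `L²(P)`, as an element of `L²(Pⁿ)`. -/
def tensorLp (P : Measure Ω) [IsProbabilityMeasure P] {n : ℕ} (φ : Fin n → Lp ℝ 2 P) :
    Lp ℝ 2 (Measure.pi fun _ : Fin n => P) :=
  (memLp_tensor P φ).toLp _

/-- The scalar product of elementary tensors is the product of the scalar products. -/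
theorem inner_tensorLp (P : Measure Ω) [IsProbabilityMeasure P] {n : ℕ}
    (φ ψ : Fin n → Lp ℝ 2 P) :
    inner ℝ (tensorLp P φ) (tensorLp P ψ) = ∏ j, inner ℝ (φ j) (ψ j) := by
  simp_rw [L2.inner_def]
  refine Eq.trans ?_ (integral_fintype_prod_eq_prod (μ := fun _ : Fin n => P)
    (fun j ω => (inner ℝ (φ j ω) (ψ j ω) : ℝ)))
  refine integral_congr_ae ?_
  filter_upwards [(memLp_tensor P φ).coeFn_toLp, (memLp_tensor P ψ).coeFn_toLp] with x h1 h2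
  simp only [tensorLp, h1, h2]
  simp [Finset.prod_mul_distrib]

/-- The Hilbert tensor power `𝓗^{⊗ n}`: the closed linear span of the elementary tensors of
elements of `𝓗`, inside `L²(P)^{⊗ n} = L²(Pⁿ)`. -/
def tensorPow (B : ℝ≥0 → Ω → ℝ) (P : Measure Ω) [IsProbabilityMeasure P] (T : ℝ≥0) (n : ℕ) :
    Submodule ℝ (Lp ℝ 2 (Measure.pi fun _ : Fin n => P)) :=
  (Submodule.span ℝ (Set.range fun φ : Fin n → hilb B P T =>
    tensorLp P fun j => (φ j : Lp ℝ 2 P))).topologicalClosure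

/-- The elementary tensor `φ₁ ⊗ ⋯ ⊗ φₙ` of elements of `𝓗`, in `𝓗^{⊗ n}`. -/
def tensor {B : ℝ≥0 → Ω → ℝ} {P : Measure Ω} [IsProbabilityMeasure P] {T : ℝ≥0} {n : ℕ}
    (φ : Fin n → hilb B P T) : tensorPow B P T n :=
  ⟨tensorLp P fun j => (φ j : Lp ℝ 2 P),
    Submodule.le_topologicalClosure _ (Submodule.subset_span ⟨φ, rfl⟩)⟩

/-- A smooth cylindrical random variable `F = f(B(φ₁), …, B(φₘ))`, with `φᵢ ∈ 𝓗` and `f` smooth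
and bounded together with all its derivatives. -/
structure SmoothCyl (B : ℝ≥0 → Ω → ℝ) (P : Measure Ω) (T : ℝ≥0) where
  m : ℕ
  f : (Fin m → ℝ) → ℝ
  φ : Fin m → hilb B P T
  smooth : ContDiff ℝ (⊤ : ℕ∞) f
  bounded : ∀ k : ℕ, ∃ C : ℝ, ∀ x, ‖iteratedFDeriv ℝ k f x‖ ≤ C

namespace SmoothCyl

variable {B : ℝ≥0 → Ω → ℝ} {P : Measure Ω} {T : ℝ≥0}

/-- The vector `(B(φ₁), …, B(φₘ))`. -/
def point (F : SmoothCyl B P T) (ω : Ω) : Fin F.m → ℝ :=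
  fun i => (F.φ i : Lp ℝ 2 P) ω

/-- The value `F(ω) = f(B(φ₁)(ω), …, B(φₘ)(ω))`. -/
def val (F : SmoothCyl B P T) (ω : Ω) : ℝ := F.f (F.point ω)

/-- The `n`-th Malliavin derivative
`DⁿF = ∑_{i₁, …, iₙ} (∂_{i₁} ⋯ ∂_{iₙ} f)(B(φ₁), …, B(φₘ)) φ_{i₁} ⊗ ⋯ ⊗ φ_{iₙ}`. -/
def malliavin [IsProbabilityMeasure P] (F : SmoothCyl B P T) (n : ℕ) (ω : Ω) :
    tensorPow B P T n :=
  ∑ i : Fin n → Fin F.m,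
    iteratedFDeriv ℝ n F.f (F.point ω) (fun j => Pi.single (i j) (1 : ℝ)) •
      tensor fun j => F.φ (i j)

end SmoothCyl

/-- `G = Iₙ(g)`, the multiple Wiener integral of order `n` of the kernel `g ∈ 𝓗^{⊗ n}` with respect
to `B`, i.e. the `n`-fold divergence of the deterministic kernel `g`: `G` is a square integrable
functional of `(B_s)_{s ≤ T}` and `E(F G) = E⟨DⁿF, g⟩` for every smooth cylindrical `F`. -/
def IsMultipleIntegral (B : ℝ≥0 → Ω → ℝ) (P : Measure Ω) [IsProbabilityMeasure P] (T : ℝ≥0)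
    (n : ℕ) (g : tensorPow B P T n) (G : Lp ℝ 2 P) : Prop :=
  AEStronglyMeasurable[sigmaAlg B T] G P ∧
    ∀ F : SmoothCyl B P T, ∫ ω, F.val ω * G ω ∂P = ∫ ω, inner ℝ (F.malliavin n ω) g ∂P

open Classical in
/-- The multiple Wiener integral `Iₙ(g)` (with value `0` if there is none). -/
def multipleIntegral (B : ℝ≥0 → Ω → ℝ) (P : Measure Ω) [IsProbabilityMeasure P] (T : ℝ≥0)
    (n : ℕ) (g : tensorPow B P T n) : Lp ℝ 2 P :=
  if h : ∃ G, IsMultipleIntegral B P T n g G then h.choose else 0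

/-- The `n`-th Wiener chaos: all multiple Wiener integrals of order `n`. -/
def chaos (B : ℝ≥0 → Ω → ℝ) (P : Measure Ω) [IsProbabilityMeasure P] (T : ℝ≥0) (n : ℕ) :
    Set (Lp ℝ 2 P) :=
  {G | ∃ g : tensorPow B P T n, IsMultipleIntegral B P T n g G}

namespace IsFBM

variable {H : ℝ} {B : ℝ≥0 → Ω → ℝ} {P : Measure Ω}

theorem memLp (hB : IsFBM H B P) (t : ℝ≥0) : MemLp (B t) 2 P :=
  (hB.gaussian.hasGaussianLaw_eval t).memLp_two

/-- The element `1_{[0,t]}` of `𝓗`, for `t ∈ [0, T]`. -/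
def ind (hB : IsFBM H B P) {t T : ℝ≥0} (htT : t ≤ T) : hilb B P T :=
  ⟨(hB.memLp t).toLp (B t), Submodule.le_topologicalClosure _
    (Submodule.subset_span ⟨t, htT, (hB.memLp t).coeFn_toLp⟩)⟩

/-- `⟨1_{[0,t]}, 1_{[0,s]}⟩ = R_H(t, s)` in `𝓗`. -/
theorem inner_ind (hB : IsFBM H B P) {t s T : ℝ≥0} (ht : t ≤ T) (hs : s ≤ T) :
    inner ℝ (hB.ind ht) (hB.ind hs) = cov H t s := by
  rw [← hB.covariance t s, Submodule.coe_inner, L2.inner_def]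
  refine integral_congr_ae ?_
  filter_upwards [(hB.memLp t).coeFn_toLp, (hB.memLp s).coeFn_toLp] with ω h1 h2
  simp only [ind, h1, h2]
  simp [mul_comm]

theorem memLp_sign [IsProbabilityMeasure P] (hB : IsFBM H B P) (t : ℝ≥0) :
    MemLp (fun ω => Real.sign (B t ω)) 2 P := by
  have hs : Measurable Real.sign := by
    unfold Real.sign
    exact Measurable.ite measurableSet_Iio measurable_const
      (Measurable.ite measurableSet_Ioi measurable_const measurable_const)
  refine MemLp.of_bound (hs.comp (hB.measurable t)).aestronglyMeasurable 1 ?_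
  refine Filter.Eventually.of_forall fun ω => ?_
  rcases Real.sign_apply_eq (B t ω) with h | h | h <;> simp [h]

/-- The random variable `sign(B_t)`, in `L²(P)`. -/
def sign [IsProbabilityMeasure P] (hB : IsFBM H B P) (t : ℝ≥0) : Lp ℝ 2 P :=
  (hB.memLp_sign t).toLp _

end IsFBM

/-- The coefficient `b_{2k+1} = 2 (-1)^k / ((2k+1) √(2π) t^{(2k+1)H} k! 2^k)`. -/
def coeff (H : ℝ) (t : ℝ≥0) (k : ℕ) : ℝ :=
  2 * (-1) ^ k /
    ((2 * k + 1) * √(2 * Real.pi) * (t : ℝ) ^ ((2 * k + 1) * H) * (k.factorial : ℝ) * 2 ^ k)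

end FBM

end

namespace FBM

/-! Let `u = 1_{[0,t]} / t^H`, a unit vector of `𝓗`, so that `N = B(u)` is standard Gaussian and
`sign(B_t) = sign(N)` almost surely. Everything reduces to Hermite polynomials in `N`.

Existence: `Iₙ(1_{[0,t]}^{⊗n}) = t^{nH} Heₙ(N)`. Write `φᵢ = Zᵢ + ⟨φᵢ, u⟩ u`; the vector `(B(Zᵢ))`
is independent of `N`, so with it frozen a cylindrical `F` is a smooth function of `N` alone, and
`n` one-dimensional integrations by parts turn `F Heₙ(N)` into the `n`-th directional derivative,
which is `⟨DⁿF, u^{⊗n}⟩` (`integral_val_mul_hermiteEval`, `inner_malliavin_tensor`). Uniqueness: the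
difference of two candidates is orthogonal to the cosines and sines of linear forms in finitely many
`B_s`, so the signed law it induces on path space vanishes (`eq_zero_of_cos_sin`).

Expansion: since `(Heₙ γ)' = -Heₙ₊₁ γ` for the Gaussian density `γ`, `E[sign(N) Heₙ₊₁(N)] = 2 Heₙ(0)
/ √(2π)`. Completeness of the Hermite system is not needed: Parseval's equality is checked directly.
The squared norms of the odd terms add up to `(2/π) ∑ (2k choose k) / (4^k (2k+1)) = (2/π) arcsin 1
= 1 = E[sign(N)²]`, so the orthogonal series converges to `sign(N)`.

Even chaoses: an even derivative of `sin` is `± sin`, so `D^{2k} sin(cB_t)` is `sin(cB_t)` times a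
fixed tensor. Hence `E[sin(cB_t) G]` is a multiple of `E[sin(cB_t)] = 0` for `G` in an even chaos.
The law of `B_t` weighted by `G` is then symmetric, and the odd function `sign` has integral zero
against it. -/

/-! ### The arcsine series at `1` -/

theorem choose_neg_half_eq (n : ℕ) :
    Ring.choose (-1 / 2 : ℝ) n = (-1) ^ n * n.centralBinom / 4 ^ n := by
  have key : ∀ n : ℕ, (descPochhammer ℤ n).smeval (-1 / 2 : ℝ) =
      n.factorial * ((-1) ^ n * n.centralBinom / 4 ^ n) := by
    intro n
    induction n with
    | zero => simp [Polynomial.smeval_one]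
    | succ n ih =>
      rw [descPochhammer_succ_right, Polynomial.smeval_mul, ih, Polynomial.smeval_sub,
        Polynomial.smeval_X, Polynomial.smeval_natCast, Nat.factorial_succ]
      have h : ((n : ℝ) + 1) * (n + 1).centralBinom = 2 * (2 * n + 1) * n.centralBinom := by
        exact_mod_cast Nat.succ_mul_centralBinom_succ n
      have h4 : (4 : ℝ) ^ n ≠ 0 := by positivity
      push_cast
      simp only [pow_one, pow_zero, nsmul_eq_mul, mul_one]
      have : ((n : ℝ) + 1) * n.factorial * ((-1) ^ (n + 1) * (n + 1).centralBinom / 4 ^ (n + 1))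
          = n.factorial *
            ((-1) ^ (n + 1) * (((n : ℝ) + 1) * (n + 1).centralBinom) / 4 ^ (n + 1)) := by
        ring
      rw [this, h]
      field_simp
      ring
  have h := Ring.descPochhammer_eq_factorial_smul_choose (-1 / 2 : ℝ) n
  rw [key n, nsmul_eq_mul] at h
  exact (mul_left_cancel₀ (by positivity) h).symm

theorem hasSum_centralBinom_mul_pow {x : ℝ} (hx : |x| < 1) :
    HasSum (fun n : ℕ => (n.centralBinom : ℝ) / 4 ^ n * x ^ (2 * n)) (1 / √(1 - x ^ 2)) := by
  have hx2 : x ^ 2 < 1 := (sq_lt_one_iff_abs_lt_one x).2 hx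
  have h := (Real.one_add_rpow_hasFPowerSeriesOnBall_zero (a := -1 / 2)).hasSum
    (y := -x ^ 2) (by simpa [Metric.mem_eball, edist_dist, dist_eq_norm] using hx)
  simp only [binomialSeries_apply, choose_neg_half_eq, List.ofFn_const, List.prod_replicate,
    smul_eq_mul, zero_add] at h
  have h1 : ∀ n : ℕ, (n.centralBinom : ℝ) / 4 ^ n * x ^ (2 * n) =
      (-1) ^ n * n.centralBinom / 4 ^ n * (-x ^ 2) ^ n := by
    intro n
    have h2 : ((-1 : ℝ) ^ n) * (-1) ^ n = 1 := by rw [← mul_pow]; norm_num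
    rw [neg_pow (x ^ 2), ← pow_mul]
    linear_combination (-(n.centralBinom : ℝ) / 4 ^ n * x ^ (2 * n)) * h2
  have h3 : 1 / √(1 - x ^ 2) = (1 + -x ^ 2) ^ (-1 / 2 : ℝ) := by
    rw [Real.sqrt_eq_rpow, ← sub_eq_add_neg, one_div, ← Real.rpow_neg (by linarith)]
    norm_num
  simp_rw [h1, h3]
  exact h

/-- The series `∑ (2k choose k) / (4^k (2k+1)) = π / 2`, the expansion of `arcsin` at `1`. -/
theorem hasSum_centralBinom_div :
    HasSum (fun n : ℕ => (n.centralBinom : ℝ) / 4 ^ n / (2 * n + 1)) (Real.pi / 2) := by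
  have hderiv : ∀ x ∈ Set.Ioo (0 : ℝ) 1, HasDerivAt Real.arcsin (1 / √(1 - x ^ 2)) x :=
    fun x hx => Real.hasDerivAt_arcsin (by linarith [hx.1]) (by linarith [hx.2])
  -- The integrand is unbounded at `1`; it is integrable as the nonnegative derivative of a function
  -- continuous up to the endpoint.
  have hint : IntegrableOn (fun x : ℝ => 1 / √(1 - x ^ 2)) (Set.Ioc 0 1) :=
    intervalIntegral.integrableOn_deriv_of_nonneg Real.continuous_arcsin.continuousOn hderiv
      fun x _ => by positivity
  have hval : ∫ x in Set.Ioc (0 : ℝ) 1, 1 / √(1 - x ^ 2) = Real.pi / 2 := by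
    rw [← intervalIntegral.integral_of_le zero_le_one,
      intervalIntegral.integral_eq_sub_of_hasDerivAt_of_le zero_le_one
        Real.continuous_arcsin.continuousOn hderiv
        ((intervalIntegrable_iff_integrableOn_Ioc_of_le zero_le_one).2 hint)]
    simp
  have hnn : ∀ n : ℕ, 0 ≤ (n.centralBinom : ℝ) / 4 ^ n / (2 * n + 1) := fun n => by positivity
  have hterm : ∀ n : ℕ, ∫⁻ x in Set.Ioo (0 : ℝ) 1,
      ENNReal.ofReal ((n.centralBinom : ℝ) / 4 ^ n * x ^ (2 * n)) =
      ENNReal.ofReal ((n.centralBinom : ℝ) / 4 ^ n / (2 * n + 1)) := by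
    intro n
    rw [← ofReal_integral_eq_lintegral_ofReal]
    · rw [← integral_Ioc_eq_integral_Ioo, ← intervalIntegral.integral_of_le zero_le_one,
        intervalIntegral.integral_const_mul, integral_pow]
      simp [div_eq_mul_inv]
    · refine ((Continuous.integrableOn_Icc (by fun_prop)).mono_set Set.Ioo_subset_Icc_self)
    · refine (ae_restrict_iff' measurableSet_Ioo).2 (.of_forall fun x hx => ?_)
      have := hx.1
      simp only [Pi.zero_apply]
      positivity
  -- Termwise integration in `ENNReal` needs only nonnegativity; summability is then read off from
  -- the finite total.
  have hsum : ∑' n : ℕ, ENNReal.ofReal ((n.centralBinom : ℝ) / 4 ^ n / (2 * n + 1)) =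
      ENNReal.ofReal (Real.pi / 2) := by
    simp_rw [← hterm]
    rw [← lintegral_tsum fun n => by fun_prop, ← hval, integral_Ioc_eq_integral_Ioo,
      ofReal_integral_eq_lintegral_ofReal (hint.mono_set Set.Ioo_subset_Ioc_self)
        (.of_forall fun x => by simp only [Pi.zero_apply]; positivity)]
    refine setLIntegral_congr_fun measurableSet_Ioo fun x hx => ?_
    have h := hasSum_centralBinom_mul_pow (x := x) (by rw [abs_of_pos hx.1]; exact hx.2)
    rw [← h.tsum_eq, ENNReal.ofReal_tsum_of_nonneg _ h.summable]
    intro n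
    have := hx.1
    positivity
  have hs : Summable fun n : ℕ => (n.centralBinom : ℝ) / 4 ^ n / (2 * n + 1) := by
    have := ENNReal.summable_toReal (hsum.trans_ne ENNReal.ofReal_ne_top)
    simpa only [ENNReal.toReal_ofReal (hnn _)] using this
  rw [← ENNReal.ofReal_tsum_of_nonneg hnn hs,
    ENNReal.ofReal_eq_ofReal_iff (tsum_nonneg hnn) (by positivity)] at hsum
  exact hsum ▸ hs.hasSum

/-! ### Hermite polynomials and Gaussian integration by parts -/

/-- The value at `x` of the `n`-th probabilist Hermite polynomial. -/
noncomputable def hermiteEval (n : ℕ) (x : ℝ) : ℝ := Polynomial.aeval x (Polynomial.hermite n)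

theorem hermiteEval_eq_eval (n : ℕ) (x : ℝ) :
    hermiteEval n x = ((Polynomial.hermite n).map (Int.castRingHom ℝ)).eval x := by
  rw [hermiteEval, Polynomial.eval_map, Polynomial.aeval_def]
  rfl

theorem continuous_hermiteEval (n : ℕ) : Continuous (hermiteEval n) :=
  Polynomial.continuous_aeval _

theorem hermiteEval_zero_left (x : ℝ) : hermiteEval 0 x = 1 := by simp [hermiteEval]

theorem hermiteEval_even_zero (k : ℕ) :
    hermiteEval (2 * k) 0 = (-1) ^ k * ((2 * k - 1).doubleFactorial : ℝ) := by
  have h := Polynomial.coeff_hermite_explicit k 0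
  simp only [add_zero, Nat.choose_zero_right, Nat.cast_one, mul_one] at h
  rw [hermiteEval_eq_eval, ← Polynomial.coeff_zero_eq_eval_zero, Polynomial.coeff_map, h]
  simp

theorem hasDerivAt_gaussianPDFReal (x : ℝ) :
    HasDerivAt (gaussianPDFReal 0 1) (-x * gaussianPDFReal 0 1 x) x := by
  rw [gaussianPDFReal_def]
  have h : HasDerivAt (fun y : ℝ => -(y - 0) ^ 2 / (2 * ((1 : ℝ≥0) : ℝ))) (-x) x := by
    have := (((hasDerivAt_id x).sub_const 0).pow 2).neg.div_const (2 * ((1 : ℝ≥0) : ℝ))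
    refine this.congr_deriv ?_
    simp
    ring
  refine ((h.exp).const_mul ((√(2 * Real.pi * ((1 : ℝ≥0) : ℝ)))⁻¹)).congr_deriv ?_
  ring

/-- The recurrence `Heₙ₊₁ = X Heₙ - Heₙ'` in analytic form. Integration by parts, and through it
orthogonality, as well as the coefficients of `sign` all come from it. -/
theorem hasDerivAt_hermiteEval_mul_gaussianPDFReal (n : ℕ) (x : ℝ) :
    HasDerivAt (fun y => hermiteEval n y * gaussianPDFReal 0 1 y)
      (-(hermiteEval (n + 1) x * gaussianPDFReal 0 1 x)) x := by
  have h := (Polynomial.hasDerivAt_aeval (Polynomial.hermite n) x).mul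
    (hasDerivAt_gaussianPDFReal x)
  refine h.congr_deriv ?_
  simp only [hermiteEval, Polynomial.hermite_succ, map_sub, map_mul, Polynomial.aeval_X]
  ring

theorem integrable_gaussianReal_iff {f : ℝ → ℝ} :
    Integrable f (gaussianReal 0 1) ↔ Integrable (fun x => f x * gaussianPDFReal 0 1 x) := by
  rw [gaussianReal_of_var_ne_zero _ one_ne_zero, integrable_withDensity_iff_integrable_smul'
    (measurable_gaussianPDF 0 1) (.of_forall fun _ => gaussianPDF_lt_top)]
  simp [toReal_gaussianPDF, mul_comm]

theorem integrable_polynomial_gaussianReal (p : Polynomial ℝ) :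
    Integrable (fun x => p.eval x) (gaussianReal 0 1) := by
  simp_rw [Polynomial.eval_eq_sum_range]
  refine integrable_finsetSum _ fun i _ => Integrable.const_mul ?_ _
  have h : MemLp (id : ℝ → ℝ) i (gaussianReal 0 1) := memLp_id_gaussianReal' _ (by simp)
  refine (h.integrable_norm_pow').mono' (by fun_prop) (.of_forall fun x => ?_)
  simp

theorem integrable_polynomial_mul_hermiteEval (p : Polynomial ℝ) (n : ℕ) :
    Integrable (fun x => p.eval x * hermiteEval n x) (gaussianReal 0 1) := by
  have h := integrable_polynomial_gaussianReal
    (p * (Polynomial.hermite n).map (Int.castRingHom ℝ))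
  simpa only [Polynomial.eval_mul, ← hermiteEval_eq_eval] using h

theorem integrable_hermiteEval (n : ℕ) : Integrable (hermiteEval n) (gaussianReal 0 1) := by
  simpa using integrable_polynomial_mul_hermiteEval 1 n

/-- Gaussian integration by parts, one step: `E[(Dh)(N) Heₙ(N)] = E[h(N) Heₙ₊₁(N)]`. -/
theorem integral_deriv_mul_hermiteEval {h h' : ℝ → ℝ} (hd : ∀ x, HasDerivAt h (h' x) x) (n : ℕ)
    (h0 : Integrable (fun x => h x * hermiteEval n x) (gaussianReal 0 1))
    (h1 : Integrable (fun x => h x * hermiteEval (n + 1) x) (gaussianReal 0 1))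
    (h2 : Integrable (fun x => h' x * hermiteEval n x) (gaussianReal 0 1)) :
    ∫ x, h' x * hermiteEval n x ∂gaussianReal 0 1 =
      ∫ x, h x * hermiteEval (n + 1) x ∂gaussianReal 0 1 := by
  rw [integrable_gaussianReal_iff] at h0 h1 h2
  have := integral_mul_deriv_eq_deriv_mul_of_integrable (u := h) (u' := h')
    (v := fun y => hermiteEval n y * gaussianPDFReal 0 1 y)
    (v' := fun x => -(hermiteEval (n + 1) x * gaussianPDFReal 0 1 x)) (fun x _ => hd x)
    (fun x _ => hasDerivAt_hermiteEval_mul_gaussianPDFReal n x)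
    (by refine h1.neg.congr (.of_forall fun x => ?_); simp [mul_assoc])
    (by refine h2.congr (.of_forall fun x => ?_); simp [mul_assoc])
    (by refine h0.congr (.of_forall fun x => ?_); simp [mul_assoc])
  simp only [mul_neg, integral_neg, neg_inj] at this
  rw [integral_gaussianReal_eq_integral_smul one_ne_zero,
    integral_gaussianReal_eq_integral_smul one_ne_zero]
  simp only [smul_eq_mul]
  calc _ = ∫ x, h' x * (hermiteEval n x * gaussianPDFReal 0 1 x) := by
        congr 1; ext x; ring
    _ = _ := this.symm
    _ = _ := by congr 1; ext x; ring

/-- Gaussian integration by parts: `E[h⁽ⁿ⁾(N)] = E[h(N) Heₙ(N)]`. -/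
theorem integral_iteratedDeriv_eq {h : ℝ → ℝ} (hs : ContDiff ℝ (⊤ : ℕ∞) h)
    (hi : ∀ k n, Integrable (fun x => iteratedDeriv k h x * hermiteEval n x) (gaussianReal 0 1))
    (n : ℕ) :
    ∫ x, iteratedDeriv n h x ∂gaussianReal 0 1 = ∫ x, h x * hermiteEval n x ∂gaussianReal 0 1 := by
  -- Quantifying over `k` lets the induction move `j` derivatives, one at a time, from any order
  -- down to `k`.
  have key : ∀ j k, ∫ x, iteratedDeriv (k + j) h x * hermiteEval 0 x ∂gaussianReal 0 1 =
      ∫ x, iteratedDeriv k h x * hermiteEval j x ∂gaussianReal 0 1 := by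
    intro j
    induction j with
    | zero => simp
    | succ j ih =>
      intro k
      rw [← integral_deriv_mul_hermiteEval (h' := iteratedDeriv (k + 1) h) _ j (hi _ _) (hi _ _)
        (hi _ _), ← ih, add_right_comm, add_assoc]
      intro x
      rw [iteratedDeriv_succ]
      exact (hs.differentiable_iteratedDeriv k
        (by exact_mod_cast WithTop.coe_lt_top _) x).hasDerivAt
  simpa [hermiteEval_zero_left] using key n 0

theorem iteratedDeriv_polynomial_eval (p : Polynomial ℝ) (n : ℕ) :
    iteratedDeriv n (fun x => p.eval x) = fun x => (Polynomial.derivative^[n] p).eval x := by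
  induction n with
  | zero => simp
  | succ n ih =>
    ext x
    rw [iteratedDeriv_succ, ih, Function.iterate_succ_apply', Polynomial.deriv]

/-- Integration by parts puts `n` derivatives on a polynomial of degree `m < n`. -/
theorem integral_hermiteEval_mul_of_lt {m n : ℕ} (h : m < n) :
    ∫ x, hermiteEval m x * hermiteEval n x ∂gaussianReal 0 1 = 0 := by
  have hp := integral_iteratedDeriv_eq
    (h := fun x => ((Polynomial.hermite m).map (Int.castRingHom ℝ)).eval x)
    (Polynomial.contDiff_aeval _ _) (fun k n => by
      simp only [iteratedDeriv_polynomial_eval]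
      exact integrable_polynomial_mul_hermiteEval _ n) n
  simp only [← hermiteEval_eq_eval] at hp
  rw [← hp, show hermiteEval m = fun x => hermiteEval m x from rfl]
  simp only [hermiteEval_eq_eval, iteratedDeriv_polynomial_eval]
  rw [Polynomial.iterate_derivative_eq_zero]
  · simp
  · exact (Polynomial.natDegree_map_le).trans_lt (by simpa using h)

/-- The `n`-th derivative of the monic polynomial `Heₙ` is the constant `n!`. -/
theorem integral_hermiteEval_mul_self (n : ℕ) :
    ∫ x, hermiteEval n x * hermiteEval n x ∂gaussianReal 0 1 = n.factorial := by
  have hp := integral_iteratedDeriv_eq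
    (h := fun x => ((Polynomial.hermite n).map (Int.castRingHom ℝ)).eval x)
    (Polynomial.contDiff_aeval _ _) (fun k n => by
      simp only [iteratedDeriv_polynomial_eval]
      exact integrable_polynomial_mul_hermiteEval _ n) n
  simp only [← hermiteEval_eq_eval] at hp
  rw [← hp, show hermiteEval n = fun x => hermiteEval n x from rfl]
  simp only [hermiteEval_eq_eval, iteratedDeriv_polynomial_eval]
  have hm : ((Polynomial.hermite n).map (Int.castRingHom ℝ)).natDegree = n := by
    rw [(Polynomial.hermite_monic n).natDegree_map, Polynomial.natDegree_hermite]
  have hC : Polynomial.derivative^[n] ((Polynomial.hermite n).map (Int.castRingHom ℝ)) =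
      Polynomial.C (n.factorial : ℝ) := by
    rw [Polynomial.eq_C_of_natDegree_le_zero
      ((Polynomial.natDegree_iterate_derivative _ _).trans (by simp [hm])),
      Polynomial.coeff_iterate_derivative]
    simp [Nat.descFactorial_self]
  simp [hC]

theorem integral_hermiteEval_mul {m n : ℕ} (h : m ≠ n) :
    ∫ x, hermiteEval m x * hermiteEval n x ∂gaussianReal 0 1 = 0 := by
  rcases h.lt_or_gt with h | h
  · exact integral_hermiteEval_mul_of_lt h
  · simp_rw [mul_comm (hermiteEval m _)]
    exact integral_hermiteEval_mul_of_lt h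

/-- On each half-line the integrand is, up to sign, the derivative of `Heₙ γ`. This function and its
derivative are integrable, so it vanishes at infinity and only the two equal boundary terms at `0`
remain. -/
theorem integral_sign_mul_hermiteEval (n : ℕ) :
    ∫ x, Real.sign x * hermiteEval (n + 1) x ∂gaussianReal 0 1 =
      2 * hermiteEval n 0 / √(2 * Real.pi) := by
  have hi := fun n => integrable_gaussianReal_iff.1 (integrable_hermiteEval n)
  have hpos : ∫ x in Set.Ioi (0 : ℝ), -(hermiteEval (n + 1) x * gaussianPDFReal 0 1 x) =
      0 - hermiteEval n 0 * gaussianPDFReal 0 1 0 :=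
    integral_Ioi_of_hasDerivAt_of_tendsto'
      (fun x _ => hasDerivAt_hermiteEval_mul_gaussianPDFReal n x) (hi _).neg.integrableOn
      (tendsto_zero_of_hasDerivAt_of_integrableOn_Ioi (a := 0)
        (fun x _ => hasDerivAt_hermiteEval_mul_gaussianPDFReal n x) (hi _).neg.integrableOn
        (hi _).integrableOn)
  have hneg : ∫ x in Set.Iic (0 : ℝ), -(hermiteEval (n + 1) x * gaussianPDFReal 0 1 x) =
      hermiteEval n 0 * gaussianPDFReal 0 1 0 - 0 :=
    integral_Iic_of_hasDerivAt_of_tendsto'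
      (fun x _ => hasDerivAt_hermiteEval_mul_gaussianPDFReal n x) (hi _).neg.integrableOn
      (tendsto_zero_of_hasDerivAt_of_integrableOn_Iic (a := 0)
        (fun x _ => hasDerivAt_hermiteEval_mul_gaussianPDFReal n x) (hi _).neg.integrableOn
        (hi _).integrableOn)
  have hpdf : gaussianPDFReal 0 1 0 = (√(2 * Real.pi))⁻¹ := by simp [gaussianPDFReal_def]
  have e1 : Set.EqOn (fun x => gaussianPDFReal 0 1 x • (Real.sign x * hermiteEval (n + 1) x))
      (fun x => hermiteEval (n + 1) x * gaussianPDFReal 0 1 x) (Set.Ioi 0) := fun x hx => by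
    simp [Real.sign_of_pos (show 0 < x from hx), mul_comm]
  have e2 : Set.EqOn (fun x => gaussianPDFReal 0 1 x • (Real.sign x * hermiteEval (n + 1) x))
      (fun x => -(hermiteEval (n + 1) x * gaussianPDFReal 0 1 x)) (Set.Iio 0) := fun x hx => by
    simp [Real.sign_of_neg (show x < 0 from hx), mul_comm]
  have i1 : IntegrableOn (fun x => gaussianPDFReal 0 1 x •
      (Real.sign x * hermiteEval (n + 1) x)) (Set.Ioi 0) :=
    (integrableOn_congr_fun e1 measurableSet_Ioi).2 (hi _).integrableOn
  have i2 : IntegrableOn (fun x => gaussianPDFReal 0 1 x •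
      (Real.sign x * hermiteEval (n + 1) x)) (Set.Iic 0) := by
    -- The formula `e2` may fail at `0`, where `sign` is `0`; the point is null.
    rw [integrableOn_Iic_iff_integrableOn_Iio]
    exact (integrableOn_congr_fun e2 measurableSet_Iio).2 (hi _).neg.integrableOn
  rw [integral_gaussianReal_eq_integral_smul one_ne_zero,
    ← intervalIntegral.integral_Iic_add_Ioi i2 i1, integral_Iic_eq_integral_Iio,
    setIntegral_congr_fun measurableSet_Iio e2,
    setIntegral_congr_fun measurableSet_Ioi e1, ← integral_Iic_eq_integral_Iio, hneg]
  rw [integral_neg] at hpos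
  rw [hpdf] at hpos ⊢
  linear_combination -hpos

/-! ### Signed laws and their Fourier transforms -/

section SignedLaw

variable {Ω : Type*} [MeasurableSpace Ω] {P : Measure Ω} {E : Type*} [MeasurableSpace E]

/-- The image under `X` of the measure with density `G⁺`. -/
noncomputable def posLaw (P : Measure Ω) (X : Ω → E) (G : Ω → ℝ) : Measure E :=
  (P.withDensity fun ω => ENNReal.ofReal (G ω)).map X

theorem isFiniteMeasure_posLaw {X : Ω → E} {G : Ω → ℝ} (hG : Integrable G P) :
    IsFiniteMeasure (posLaw P X G) := by
  have := isFiniteMeasure_withDensity_ofReal hG.2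
  unfold posLaw
  infer_instance

theorem posLaw_zero (X : Ω → E) : posLaw P X (fun _ => 0) = 0 := by
  simp [posLaw]

theorem map_posLaw {E' : Type*} [MeasurableSpace E'] {X : Ω → E} (hX : Measurable X) (G : Ω → ℝ)
    {π : E → E'} (hπ : Measurable π) : (posLaw P X G).map π = posLaw P (fun ω => π (X ω)) G := by
  rw [posLaw, Measure.map_map hπ hX]
  rfl

variable {F : Type*} [NormedAddCommGroup F] [NormedSpace ℝ F]

/-- `ENNReal.ofReal` truncates, so `G` and `-G` give the densities `G⁺` and `G⁻`. The pair of finite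
positive measures stands for the signed law of `X` weighted by `G`. -/
theorem integral_posLaw_sub {X : Ω → E} (hX : Measurable X) {G : Ω → ℝ} (hG : Integrable G P)
    {h : E → F} (hh : StronglyMeasurable h) {C : ℝ} (hC : ∀ x, ‖h x‖ ≤ C) :
    ∫ x, h x ∂posLaw P X G - ∫ x, h x ∂posLaw P X (fun ω => -G ω) = ∫ ω, G ω • h (X ω) ∂P := by
  have key : ∀ G : Ω → ℝ, Integrable G P →
      ∫ x, h x ∂posLaw P X G = ∫ ω, (max (G ω) 0) • h (X ω) ∂P := by
    intro G hG
    rw [posLaw, integral_map hX.aemeasurable hh.aestronglyMeasurable,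
      integral_withDensity_eq_integral_toReal_smul₀ hG.aemeasurable.ennreal_ofReal (by simp)]
    simp [ENNReal.toReal_ofReal']
  have hint : ∀ G : Ω → ℝ, Integrable G P → Integrable (fun ω => (max (G ω) 0) • h (X ω)) P :=
    fun G hG => hG.pos_part.smul_bdd (C := C)
      (hh.comp_measurable hX).aestronglyMeasurable (.of_forall fun ω => hC _)
  rw [key G hG, key (fun ω => -G ω) hG.neg,
    ← integral_sub (hint G hG) (hint (fun ω => -G ω) hG.neg)]
  congr 1
  ext ω
  rw [← sub_smul, max_zero_sub_max_neg_zero_eq_self]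

end SignedLaw

section CharFun

variable {Ω : Type*} [MeasurableSpace Ω] {P : Measure Ω}

theorem integral_smul_exp_eq {Y : Ω → ℝ} (hY : Measurable Y) {G : Ω → ℝ} (hG : Integrable G P) :
    ∫ ω, G ω • Complex.exp (Y ω * Complex.I) ∂P =
      ((∫ ω, Real.cos (Y ω) * G ω ∂P : ℝ) : ℂ) +
        ((∫ ω, Real.sin (Y ω) * G ω ∂P : ℝ) : ℂ) * Complex.I := by
  have hc : Integrable (fun ω => Real.cos (Y ω) * G ω) P :=
    hG.bdd_mul (c := 1) (Real.continuous_cos.measurable.comp hY).aestronglyMeasurable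
      (.of_forall fun ω => by simpa using Real.abs_cos_le_one _)
  have hs : Integrable (fun ω => Real.sin (Y ω) * G ω) P :=
    hG.bdd_mul (c := 1) (Real.continuous_sin.measurable.comp hY).aestronglyMeasurable
      (.of_forall fun ω => by simpa using Real.abs_sin_le_one _)
  rw [← integral_complex_ofReal, ← integral_complex_ofReal, ← integral_mul_const,
    ← integral_add hc.ofReal (hs.ofReal.mul_const _)]
  congr 1
  ext ω
  rw [Complex.exp_mul_I]
  simp only [Complex.real_smul, Complex.ofReal_mul, Complex.ofReal_cos,
    Complex.ofReal_sin]
  ring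

variable {E : Type*} [NormedAddCommGroup E] [NormedSpace ℝ E] [MeasurableSpace E] [BorelSpace E]
  [SecondCountableTopology E] [CompleteSpace E]

/-- Equality of the signed laws `(G₁ P) ∘ X₁⁻¹` and `(G₂ P) ∘ X₂⁻¹` from equality of their
Fourier transforms. -/
theorem posLaw_add_eq_of_cos_sin {X₁ X₂ : Ω → E} (h₁ : Measurable X₁) (h₂ : Measurable X₂)
    {G₁ G₂ : Ω → ℝ} (hG₁ : Integrable G₁ P) (hG₂ : Integrable G₂ P)
    (hcos : ∀ L : StrongDual ℝ E,
      ∫ ω, Real.cos (L (X₁ ω)) * G₁ ω ∂P = ∫ ω, Real.cos (L (X₂ ω)) * G₂ ω ∂P)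
    (hsin : ∀ L : StrongDual ℝ E,
      ∫ ω, Real.sin (L (X₁ ω)) * G₁ ω ∂P = ∫ ω, Real.sin (L (X₂ ω)) * G₂ ω ∂P) :
    posLaw P X₁ G₁ + posLaw P X₂ (fun ω => -G₂ ω) =
      posLaw P X₁ (fun ω => -G₁ ω) + posLaw P X₂ G₂ := by
  have := isFiniteMeasure_posLaw (X := X₁) hG₁
  have : IsFiniteMeasure (posLaw P X₁ fun ω => -G₁ ω) := isFiniteMeasure_posLaw hG₁.neg
  have := isFiniteMeasure_posLaw (X := X₂) hG₂
  have : IsFiniteMeasure (posLaw P X₂ fun ω => -G₂ ω) := isFiniteMeasure_posLaw hG₂.neg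
  -- Negative parts have been moved across the equality, so both sides are finite positive measures,
  -- determined by their characteristic functions.
  refine Measure.ext_of_charFunDual ?_
  ext L
  have hm : StronglyMeasurable fun v : E => Complex.exp (L v * Complex.I) :=
    Continuous.stronglyMeasurable (by fun_prop)
  have hb : ∀ v : E, ‖Complex.exp (L v * Complex.I)‖ ≤ 1 :=
    fun v => (Complex.norm_exp_ofReal_mul_I _).le
  have hi : ∀ (μ : Measure E) [IsFiniteMeasure μ],
      Integrable (fun v : E => Complex.exp (L v * Complex.I)) μ := fun μ _ =>
    .of_bound hm.aestronglyMeasurable 1 (.of_forall hb)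
  simp only [charFunDual_apply]
  rw [integral_add_measure (hi _) (hi _), integral_add_measure (hi _) (hi _)]
  have e₁ := integral_posLaw_sub h₁ hG₁ hm hb
  have e₂ := integral_posLaw_sub h₂ hG₂ hm hb
  rw [integral_smul_exp_eq (Y := fun ω => L (X₁ ω)) (L.continuous.measurable.comp h₁) hG₁,
    hcos, hsin] at e₁
  rw [integral_smul_exp_eq (Y := fun ω => L (X₂ ω)) (L.continuous.measurable.comp h₂) hG₂,
    ← e₁] at e₂
  linear_combination -e₂

/-- Passes from trigonometric to bounded measurable test functions, which is needed for the
discontinuous function `sign`. -/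
theorem integral_comp_mul_eq_of_cos_sin {X₁ X₂ : Ω → E} (h₁ : Measurable X₁) (h₂ : Measurable X₂)
    {G₁ G₂ : Ω → ℝ} (hG₁ : Integrable G₁ P) (hG₂ : Integrable G₂ P)
    (hcos : ∀ L : StrongDual ℝ E,
      ∫ ω, Real.cos (L (X₁ ω)) * G₁ ω ∂P = ∫ ω, Real.cos (L (X₂ ω)) * G₂ ω ∂P)
    (hsin : ∀ L : StrongDual ℝ E,
      ∫ ω, Real.sin (L (X₁ ω)) * G₁ ω ∂P = ∫ ω, Real.sin (L (X₂ ω)) * G₂ ω ∂P)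
    {h : E → ℝ} (hh : Measurable h) {C : ℝ} (hC : ∀ x, |h x| ≤ C) :
    ∫ ω, h (X₁ ω) * G₁ ω ∂P = ∫ ω, h (X₂ ω) * G₂ ω ∂P := by
  have := isFiniteMeasure_posLaw (X := X₁) hG₁
  have : IsFiniteMeasure (posLaw P X₁ fun ω => -G₁ ω) := isFiniteMeasure_posLaw hG₁.neg
  have := isFiniteMeasure_posLaw (X := X₂) hG₂
  have : IsFiniteMeasure (posLaw P X₂ fun ω => -G₂ ω) := isFiniteMeasure_posLaw hG₂.neg
  have hi : ∀ (μ : Measure E) [IsFiniteMeasure μ], Integrable h μ := fun μ _ =>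
    .of_bound hh.aestronglyMeasurable C (.of_forall hC)
  have key := congrArg (fun μ => ∫ x, h x ∂μ) (posLaw_add_eq_of_cos_sin h₁ h₂ hG₁ hG₂ hcos hsin)
  beta_reduce at key
  rw [integral_add_measure (hi _) (hi _), integral_add_measure (hi _) (hi _)] at key
  have e₁ := integral_posLaw_sub h₁ hG₁ hh.stronglyMeasurable hC
  have e₂ := integral_posLaw_sub h₂ hG₂ hh.stronglyMeasurable hC
  simp only [smul_eq_mul, mul_comm (G₁ _), mul_comm (G₂ _)] at e₁ e₂
  rw [← e₁, ← e₂]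
  linear_combination key

/-- A square integrable functional of a family of random variables vanishes when it is orthogonal
to the trigonometric functions of finitely many members of the family. -/
theorem eq_zero_of_cos_sin [IsFiniteMeasure P] {ι : Type*} {X : ι → Ω → ℝ}
    (hX : ∀ i, Measurable (X i)) (G : Lp ℝ 2 P)
    (hG : AEStronglyMeasurable[⨆ i, MeasurableSpace.comap (X i) inferInstance] G P)
    (hcos : ∀ (I : Finset ι) (L : StrongDual ℝ (I → ℝ)),
      ∫ ω, Real.cos (L fun i => X i ω) * G ω ∂P = 0)
    (hsin : ∀ (I : Finset ι) (L : StrongDual ℝ (I → ℝ)),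
      ∫ ω, Real.sin (L fun i => X i ω) * G ω ∂P = 0) :
    G = 0 := by
  have hint : Integrable G P := (Lp.memLp G).integrable (by norm_num)
  have hXm : Measurable fun ω i => X i ω := measurable_pi_lambda _ hX
  have hle : (⨆ i, MeasurableSpace.comap (X i) inferInstance) ≤ ‹MeasurableSpace Ω› :=
    iSup_le fun i => (hX i).comap_le
  -- The two parts have the same finite-dimensional marginals, and a projective limit of finite
  -- measures is unique.
  have hlaw : posLaw P (fun ω i => X i ω) G = posLaw P (fun ω i => X i ω) (fun ω => -G ω) := by
    have := fun I : Finset ι =>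
      isFiniteMeasure_posLaw (X := fun ω => I.restrict fun i => X i ω) hint
    refine IsProjectiveLimit.unique
      (P := fun I => posLaw P (fun ω => I.restrict fun i => X i ω) G) (fun I => ?_) (fun I => ?_)
    · exact map_posLaw hXm _ (Finset.measurable_restrict I)
    · rw [map_posLaw hXm _ (Finset.measurable_restrict I)]
      have hm : Measurable fun ω => I.restrict fun i => X i ω :=
        (Finset.measurable_restrict I).comp hXm
      have := posLaw_add_eq_of_cos_sin hm hm hint (G₂ := fun _ => 0) (integrable_zero Ω ℝ P)
        (fun L => (hcos I L).trans (by simp)) (fun L => (hsin I L).trans (by simp))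
      simpa [posLaw_zero] using this.symm
  have hset : ∀ s, MeasurableSet[⨆ i, MeasurableSpace.comap (X i) inferInstance] s →
      ∫ ω in s, G ω ∂P = 0 := by
    intro s hs
    have hcomap : (⨆ i, MeasurableSpace.comap (X i) inferInstance) =
        MeasurableSpace.comap (fun ω i => X i ω) MeasurableSpace.pi := by
      simp only [MeasurableSpace.pi, MeasurableSpace.comap_iSup, MeasurableSpace.comap_comp]
      rfl
    rw [hcomap] at hs
    obtain ⟨A, hA, rfl⟩ := hs
    have h := integral_posLaw_sub hXm hint (h := A.indicator fun _ => (1 : ℝ))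
      (stronglyMeasurable_const.indicator hA) (C := 1)
      (fun x => by by_cases hx : x ∈ A <;> simp [hx])
    rw [hlaw, sub_self] at h
    rw [← integral_indicator (hXm hA), h]
    congr 1
    ext ω
    by_cases hx : (fun i => X i ω) ∈ A <;> simp [Set.indicator, hx]
  have := Lp.ae_eq_zero_of_forall_setIntegral_eq_zero' ℝ hle G (by norm_num) (by norm_num)
    (fun s _ _ => hint.integrableOn) (fun s hs _ => hset s hs) hG
  exact (Lp.eq_zero_iff_ae_eq_zero).2 this

end CharFun

/-! ### Trigonometric cylindrical variables and uniqueness of multiple integrals -/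

variable {Ω : Type*} [MeasurableSpace Ω] {P : Measure Ω} {B : ℝ≥0 → Ω → ℝ} {T : ℝ≥0} {H : ℝ}

theorem iteratedFDeriv_comp_dual_apply {m : ℕ} {g : ℝ → ℝ} (hg : ContDiff ℝ (⊤ : ℕ∞) g)
    (L : StrongDual ℝ (Fin m → ℝ)) (k : ℕ) (x : Fin m → ℝ) (y : Fin k → Fin m → ℝ) :
    iteratedFDeriv ℝ k (fun z => g (L z)) x y = (∏ i, L (y i)) * iteratedDeriv k g (L x) := by
  have h := L.iteratedFDeriv_comp_right hg x (i := k) (by exact_mod_cast le_top)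
  rw [show (fun z => g (L z)) = g ∘ L from rfl, h,
    ContinuousMultilinearMap.compContinuousLinearMap_apply,
    iteratedFDeriv_apply_eq_iteratedDeriv_mul_prod]
  simp

/-- The smooth cylindrical variable `g(L(B(φ₁), …, B(φₘ)))` for a linear form `L`. -/
@[simps]
noncomputable def ridgeCyl {m : ℕ} (φ : Fin m → hilb B P T) (L : StrongDual ℝ (Fin m → ℝ))
    (g : ℝ → ℝ) (hg : ContDiff ℝ (⊤ : ℕ∞) g) (hb : ∀ k x, |iteratedDeriv k g x| ≤ 1) :
    SmoothCyl B P T where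
  m := m
  f := fun x => g (L x)
  φ := φ
  smooth := hg.comp L.contDiff
  bounded k := by
    refine ⟨‖L‖ ^ k, fun x => ContinuousMultilinearMap.opNorm_le_bound (by positivity) fun y => ?_⟩
    rw [iteratedFDeriv_comp_dual_apply hg, norm_mul, norm_prod]
    calc (∏ i, ‖L (y i)‖) * ‖iteratedDeriv k g (L x)‖ ≤ (∏ i, (‖L‖ * ‖y i‖)) * 1 := by
          gcongr with i
          · exact L.le_opNorm _
          · exact hb k _
      _ = ‖L‖ ^ k * ∏ i, ‖y i‖ := by simp [Finset.prod_mul_distrib]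

/-- A multiple integral is determined by its kernel. -/
theorem IsMultipleIntegral.unique [IsProbabilityMeasure P] (hB : IsFBM H B P) {n : ℕ}
    {g : tensorPow B P T n} {G G' : Lp ℝ 2 P} (hG : IsMultipleIntegral B P T n g G)
    (hG' : IsMultipleIntegral B P T n g G') : G = G' := by
  rw [← sub_eq_zero]
  have hint : ∀ G : Lp ℝ 2 P, Integrable G P := fun G => (Lp.memLp G).integrable (by norm_num)
  have key : ∀ (g : ℝ → ℝ) (hg : ContDiff ℝ (⊤ : ℕ∞) g) (hb : ∀ k x, |iteratedDeriv k g x| ≤ 1)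
      (I : Finset (Set.Iic T)) (L : StrongDual ℝ (I → ℝ)),
      ∫ ω, g (L fun i => B (i : Set.Iic T) ω) * (G - G' : Lp ℝ 2 P) ω ∂P = 0 := by
    intro g hg hb I L
    -- `SmoothCyl` takes its arguments indexed by `Fin m`, so the finite set of times is enumerated
    -- and `L` reindexed through `A`.
    let e := I.equivFin
    let A : (Fin I.card → ℝ) →L[ℝ] (I → ℝ) :=
      LinearMap.toContinuousLinearMap (LinearMap.funLeft ℝ ℝ e)
    let F : SmoothCyl B P T := ridgeCyl (fun j => hB.ind (e.symm j).1.2) (L.comp A) g hg hb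
    have hF : ∀ᵐ ω ∂P, F.val ω = g (L fun i => B (i : Set.Iic T) ω) := by
      have : ∀ᵐ ω ∂P, ∀ j : Fin I.card,
          (hB.ind (e.symm j).1.2 : Lp ℝ 2 P) ω = B (e.symm j).1 ω :=
        ae_all_iff.2 fun j => (hB.memLp _).coeFn_toLp
      filter_upwards [this] with ω hω
      have : A (fun j => (hB.ind (e.symm j).1.2 : Lp ℝ 2 P) ω) =
          fun i : I => B (i : Set.Iic T) ω := by
        ext i
        simp only [hω]
        simp [A, LinearMap.funLeft_apply]
      change g (L (A fun j => (hB.ind (e.symm j).1.2 : Lp ℝ 2 P) ω)) = _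
      rw [this]
    have hm : AEStronglyMeasurable (fun ω => g (L fun i => B (i : Set.Iic T) ω)) P :=
      ((hg.continuous.comp L.continuous).measurable.comp
        (measurable_pi_lambda _ fun i => hB.measurable _)).aestronglyMeasurable
    have hi : ∀ G : Lp ℝ 2 P, Integrable (fun ω => g (L fun i => B (i : Set.Iic T) ω) * G ω) P :=
      fun G => (hint G).bdd_mul (c := 1) hm (.of_forall fun ω => by simpa using hb 0 _)
    have e1 : ∀ G : Lp ℝ 2 P, ∫ ω, g (L fun i => B (i : Set.Iic T) ω) * G ω ∂P =
        ∫ ω, F.val ω * G ω ∂P := fun G =>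
      integral_congr_ae (hF.mono fun ω hω => by simp only [hω])
    calc ∫ ω, g (L fun i => B (i : Set.Iic T) ω) * (G - G' : Lp ℝ 2 P) ω ∂P
        = ∫ ω, (g (L fun i => B (i : Set.Iic T) ω) * G ω -
            g (L fun i => B (i : Set.Iic T) ω) * G' ω) ∂P := by
          refine integral_congr_ae ?_
          filter_upwards [Lp.coeFn_sub G G'] with ω hω
          rw [hω, Pi.sub_apply, mul_sub]
      _ = 0 := by
          rw [integral_sub (hi G) (hi G'), e1, e1, hG.2 F, hG'.2 F, sub_self]
  exact eq_zero_of_cos_sin (X := fun s : Set.Iic T => B s) (fun s => hB.measurable s) _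
    ((hG.1.sub hG'.1).congr (Lp.coeFn_sub G G').symm)
    (key Real.cos Real.contDiff_cos Real.abs_iteratedDeriv_cos_le_one)
    (key Real.sin Real.contDiff_sin Real.abs_iteratedDeriv_sin_le_one)

/-! ### The Gaussian space: characteristic functions and independence -/

theorem norm_sq_eq_integral (X : Lp ℝ 2 P) : ‖X‖ ^ 2 = ∫ ω, X ω ^ 2 ∂P := by
  rw [← real_inner_self_eq_norm_sq, L2.inner_def]
  simp [pow_two]

theorem coeFn_sum_smul {n : ℕ} (c : Fin n → ℝ) (g : Fin n → Lp ℝ 2 P) :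
    (∑ i, c i • g i : Lp ℝ 2 P) =ᵐ[P] fun ω => ∑ i, c i * g i ω := by
  have h2 : ∀ᵐ ω ∂P, ∀ i, (c i • g i : Lp ℝ 2 P) ω = c i * g i ω :=
    ae_all_iff.2 fun i => by
      filter_upwards [Lp.coeFn_smul (c i) (g i)] with ω h
      simp [h]
  filter_upwards [Lp.coeFn_finsetSum Finset.univ (fun i => c i • g i), h2] with ω h h2
  rw [h, Finset.sum_apply]
  simp only [h2]

theorem integral_exp_of_mem_span (hB : IsFBM H B P) {X : Lp ℝ 2 P}
    (hX : X ∈ Submodule.span ℝ {X : Lp ℝ 2 P | ∃ s ≤ T, X =ᵐ[P] B s}) :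
    ∫ ω, Complex.exp (X ω * Complex.I) ∂P = Complex.exp (-(‖X‖ ^ 2 : ℝ) / 2) := by
  have := hB.gaussian.isProbabilityMeasure
  obtain ⟨n, c, g, rfl⟩ := Submodule.mem_span_set'.1 hX
  choose s _ hgs using fun i => (g i).2
  have hae : (∑ i, c i • (g i : Lp ℝ 2 P) : Lp ℝ 2 P) =ᵐ[P] fun ω => ∑ i, c i * B (s i) ω := by
    filter_upwards [coeFn_sum_smul c fun i => (g i : Lp ℝ 2 P), ae_all_iff.2 hgs] with ω h h2
    simp only [h, h2]
  set X : Lp ℝ 2 P := ∑ i, c i • (g i : Lp ℝ 2 P)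
  have hgauss : HasGaussianLaw X P := by
    let I : Finset ℝ≥0 := Finset.univ.image s
    let L : (I → ℝ) →L[ℝ] ℝ :=
      ∑ i, c i • ContinuousLinearMap.proj (⟨s i, Finset.mem_image_of_mem _ (Finset.mem_univ i)⟩ : I)
    refine ((hB.gaussian.hasGaussianLaw I).map_fun L).congr ?_
    filter_upwards [hae] with ω hω
    simp [hω, L]
  have hmean : ∫ ω, X ω ∂P = 0 := by
    rw [integral_congr_ae hae, integral_finsetSum _ fun i _ =>
      ((hB.memLp (s i)).integrable (by norm_num)).const_mul _]
    simp [integral_const_mul, hB.mean_zero]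
  have hlaw := hgauss.map_eq_gaussianReal
  rw [hmean, variance_of_integral_eq_zero (Lp.aestronglyMeasurable X).aemeasurable hmean] at hlaw
  simp only [← norm_sq_eq_integral] at hlaw
  have h := charFun_gaussianReal (μ := 0) (v := (‖X‖ ^ 2).toNNReal) 1
  rw [← hlaw, charFun_apply, integral_map (Lp.aestronglyMeasurable X).aemeasurable
    (by fun_prop)] at h
  simpa [Real.coe_toNNReal _ (sq_nonneg ‖X‖), neg_div] using h

/-- Every element of the Gaussian space is a centred Gaussian variable with variance its squared
norm. -/
theorem integral_exp_of_mem_hilb (hB : IsFBM H B P) {X : Lp ℝ 2 P} (hX : X ∈ hilb B P T) :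
    ∫ ω, Complex.exp (X ω * Complex.I) ∂P = Complex.exp (-(‖X‖ ^ 2 : ℝ) / 2) := by
  have := hB.gaussian.isProbabilityMeasure
  rw [hilb, ← SetLike.mem_coe, Submodule.topologicalClosure_coe] at hX
  obtain ⟨x, hx, hlim⟩ := mem_closure_iff_seq_limit.1 hX
  -- An almost surely convergent subsequence suffices: the exponentials are bounded by `1`, and the
  -- norms converge anyway.
  obtain ⟨ns, hns, hae⟩ := (tendstoInMeasure_of_tendsto_Lp hlim).exists_seq_tendsto_ae
  have h1 : Filter.Tendsto (fun k => ∫ ω, Complex.exp (x (ns k) ω * Complex.I) ∂P) Filter.atTop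
      (nhds (∫ ω, Complex.exp (X ω * Complex.I) ∂P)) := by
    refine tendsto_integral_of_dominated_convergence (fun _ => 1) (fun k => ?_)
      (integrable_const _) (fun k => .of_forall fun ω => ?_) ?_
    · exact (Continuous.comp_aestronglyMeasurable (g := fun y : ℝ => Complex.exp (y * Complex.I))
        (by fun_prop) (Lp.aestronglyMeasurable (x (ns k))))
    · exact (Complex.norm_exp_ofReal_mul_I _).le
    · filter_upwards [hae] with ω hω
      exact ((Continuous.tendsto (f := fun y : ℝ => Complex.exp (y * Complex.I))
        (by fun_prop) _).comp hω)
  have h2 : Filter.Tendsto (fun k => Complex.exp (-(‖x (ns k)‖ ^ 2 : ℝ) / 2)) Filter.atTop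
      (nhds (Complex.exp (-(‖X‖ ^ 2 : ℝ) / 2))) :=
    (Continuous.tendsto (f := fun y : Lp ℝ 2 P => Complex.exp (-(‖y‖ ^ 2 : ℝ) / 2))
      (by fun_prop) _).comp (hlim.comp hns.tendsto_atTop)
  refine tendsto_nhds_unique h1 (h2.congr fun k => ?_)
  exact (integral_exp_of_mem_span hB (hx _)).symm

theorem hilb_inner_smul_left (c : ℝ) (x y : hilb B P T) :
    inner ℝ (c • x) y = c * inner ℝ x y :=
  real_inner_smul_left (x : Lp ℝ 2 P) (y : Lp ℝ 2 P) c

theorem hilb_inner_smul_right (c : ℝ) (x y : hilb B P T) :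
    inner ℝ x (c • y) = c * inner ℝ x y :=
  real_inner_smul_right (x : Lp ℝ 2 P) (y : Lp ℝ 2 P) c

/-- Linear forms in the `B(φᵢ)` stay in the Gaussian space, which reduces joint characteristic
functions to `integral_exp_of_mem_hilb`. -/
theorem coeFn_dual_comb {m : ℕ} (φ : Fin m → hilb B P T) (L : StrongDual ℝ (Fin m → ℝ)) :
    ((∑ i, L (Pi.single i 1) • φ i : hilb B P T) : Lp ℝ 2 P) =ᵐ[P]
      fun ω => L fun i => (φ i : Lp ℝ 2 P) ω := by
  have h : ((∑ i, L (Pi.single i 1) • φ i : hilb B P T) : Lp ℝ 2 P) =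
      ∑ i, L (Pi.single i 1) • (φ i : Lp ℝ 2 P) := by simp
  rw [h]
  filter_upwards [coeFn_sum_smul (fun i => L (Pi.single i 1)) fun i => (φ i : Lp ℝ 2 P)]
    with ω hω
  rw [hω]
  conv_rhs => rw [← LinearMap.sum_single_apply _ (fun i => (φ i : Lp ℝ 2 P) ω), map_sum]
  refine Finset.sum_congr rfl fun i _ => ?_
  rw [mul_comm, ← smul_eq_mul, ← map_smul, ← Pi.single_smul, smul_eq_mul, mul_one]

theorem aemeasurable_vec {m : ℕ} (φ : Fin m → hilb B P T) :
    AEMeasurable (fun ω i => (φ i : Lp ℝ 2 P) ω) P :=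
  aemeasurable_pi_lambda _ fun i => (Lp.aestronglyMeasurable (φ i : Lp ℝ 2 P)).aemeasurable

theorem map_eq_gaussianReal (hB : IsFBM H B P) {u : hilb B P T} (hu : ‖u‖ = 1) :
    P.map (u : Lp ℝ 2 P) = gaussianReal 0 1 := by
  have := hB.gaussian.isProbabilityMeasure
  have hm := (Lp.aestronglyMeasurable (u : Lp ℝ 2 P)).aemeasurable
  have := Measure.isProbabilityMeasure_map hm
  refine Measure.ext_of_charFun ?_
  ext s
  rw [charFun_gaussianReal, charFun_apply, integral_map hm (by fun_prop)]
  have h := integral_exp_of_mem_hilb hB (s • u).2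
  have h2 : ‖((s • u : hilb B P T) : Lp ℝ 2 P)‖ ^ 2 = s ^ 2 := by
    change ‖s • u‖ ^ 2 = s ^ 2
    rw [norm_smul, hu]
    simp
  rw [h2] at h
  have h3 : ∫ ω, Complex.exp (((s • u : hilb B P T) : Lp ℝ 2 P) ω * Complex.I) ∂P =
      ∫ ω, Complex.exp ((inner ℝ ((u : Lp ℝ 2 P) ω) s : ℝ) * Complex.I) ∂P := by
    refine integral_congr_ae ?_
    filter_upwards [Lp.coeFn_smul s (u : Lp ℝ 2 P)] with ω hω
    simp [hω]
  rw [← h3, h]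
  simp [neg_div]

/-- Members of the Gaussian space orthogonal to `u` are independent of `u`. -/
theorem indepFun_of_orthogonal (hB : IsFBM H B P) {m : ℕ} (φ : Fin m → hilb B P T)
    (u : hilb B P T) (h : ∀ i, inner ℝ (φ i) u = 0) :
    IndepFun (fun ω i => (φ i : Lp ℝ 2 P) ω) (u : Lp ℝ 2 P) P := by
  have := hB.gaussian.isProbabilityMeasure
  have hu := (Lp.aestronglyMeasurable (u : Lp ℝ 2 P)).aemeasurable
  have hφ := aemeasurable_vec φ
  rw [indepFun_iff_charFunDual_prod hφ hu]
  intro L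
  simp only [charFunDual_apply]
  rw [integral_map (hφ.prodMk hu) (by fun_prop), integral_map hφ (by fun_prop),
    integral_map hu (by fun_prop)]
  set L₁ := L ∘SL ContinuousLinearMap.inl ℝ (Fin m → ℝ) ℝ with hL₁
  set L₂ := L ∘SL ContinuousLinearMap.inr ℝ (Fin m → ℝ) ℝ with hL₂
  have hL : ∀ a b, L (a, b) = L₁ a + L₂ b := fun a b => by simp [hL₁, hL₂, ← map_add]
  have hL2 : ∀ b, L₂ b = L₂ 1 * b := fun b => by
    rw [← mul_one b, ← smul_eq_mul b, map_smul]; simp [mul_comm]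
  let X : hilb B P T := ∑ i, L₁ (Pi.single i 1) • φ i
  have hX : (X : Lp ℝ 2 P) =ᵐ[P] fun ω => L₁ fun i => (φ i : Lp ℝ 2 P) ω := coeFn_dual_comb φ L₁
  have hU : ((L₂ 1 • u : hilb B P T) : Lp ℝ 2 P) =ᵐ[P] fun ω => L₂ ((u : Lp ℝ 2 P) ω) := by
    filter_upwards [Lp.coeFn_smul (L₂ 1) (u : Lp ℝ 2 P)] with ω hω
    rw [hL2 ((u : Lp ℝ 2 P) ω), Submodule.coe_smul, hω]
    rfl
  have hXU : ((X + L₂ 1 • u : hilb B P T) : Lp ℝ 2 P) =ᵐ[P]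
      fun ω => L (fun i => (φ i : Lp ℝ 2 P) ω, (u : Lp ℝ 2 P) ω) := by
    filter_upwards [hX, hU, Lp.coeFn_add (X : Lp ℝ 2 P) ((L₂ 1 • u : hilb B P T) : Lp ℝ 2 P)]
      with ω h1 h2 h3
    rw [Submodule.coe_add, h3, Pi.add_apply, h1, h2, hL]
  have horth : inner ℝ X (L₂ 1 • u) = 0 := by
    simp only [X, sum_inner, hilb_inner_smul_left, hilb_inner_smul_right, h, mul_zero,
      Finset.sum_const_zero]
  have c : ∀ {Y : Lp ℝ 2 P} {Z : Ω → ℝ}, Y =ᵐ[P] Z → ∫ ω, Complex.exp (Z ω * Complex.I) ∂P =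
      ∫ ω, Complex.exp (Y ω * Complex.I) ∂P := fun h =>
    integral_congr_ae (h.mono fun ω hω => by simp only [hω])
  rw [c hX, c hU, c hXU, integral_exp_of_mem_hilb hB X.2, integral_exp_of_mem_hilb hB (L₂ 1 • u).2,
    integral_exp_of_mem_hilb hB (X + L₂ 1 • u).2, ← Complex.exp_add]
  -- By Pythagoras the exponents add, so the joint characteristic function factorises.
  have := norm_add_sq_eq_norm_sq_add_norm_sq_of_inner_eq_zero _ _ horth
  simp only [← Submodule.coe_norm, pow_two, this]
  push_cast
  ring_nf

/-! ### Integration by parts along one direction of the Gaussian space -/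

theorem contDiff_comp_line {m : ℕ} {f : (Fin m → ℝ) → ℝ} (hf : ContDiff ℝ (⊤ : ℕ∞) f)
    (z w : Fin m → ℝ) : ContDiff ℝ (⊤ : ℕ∞) fun y : ℝ => f (z + y • w) :=
  hf.comp (by fun_prop)

theorem iteratedDeriv_comp_line {m : ℕ} {f : (Fin m → ℝ) → ℝ} (hf : ContDiff ℝ (⊤ : ℕ∞) f)
    (z w : Fin m → ℝ) (k : ℕ) (y : ℝ) :
    iteratedDeriv k (fun y : ℝ => f (z + y • w)) y =
      iteratedFDeriv ℝ k f (z + y • w) fun _ => w := by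
  let L : ℝ →L[ℝ] (Fin m → ℝ) := (ContinuousLinearMap.id ℝ ℝ).smulRight w
  have h : (fun y : ℝ => f (z + y • w)) = (fun x => f (z + x)) ∘ L := rfl
  have hc : ContDiff ℝ (⊤ : ℕ∞) fun x => f (z + x) := hf.comp (by fun_prop)
  rw [iteratedDeriv, h, L.iteratedFDeriv_comp_right hc y (by exact_mod_cast le_top),
    ContinuousMultilinearMap.compContinuousLinearMap_apply, iteratedFDeriv_comp_add_left]
  simp [L]

theorem abs_iteratedFDeriv_le_of_bounded {m : ℕ} {f : (Fin m → ℝ) → ℝ} {k : ℕ} {C : ℝ}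
    (hC : ∀ x, ‖iteratedFDeriv ℝ k f x‖ ≤ C) (x w : Fin m → ℝ) :
    |iteratedFDeriv ℝ k f x fun _ => w| ≤ C * ‖w‖ ^ k := by
  refine ((iteratedFDeriv ℝ k f x).le_opNorm _).trans ?_
  simp only [Finset.prod_const, Finset.card_univ, Fintype.card_fin]
  gcongr
  exact hC x

/-- Gaussian integration by parts in the direction of a unit vector `u` of the Gaussian space. -/
theorem integral_val_mul_hermiteEval (hB : IsFBM H B P) (F : SmoothCyl B P T) {u : hilb B P T}
    (hu : ‖u‖ = 1) (n : ℕ) :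
    ∫ ω, F.val ω * hermiteEval n ((u : Lp ℝ 2 P) ω) ∂P =
      ∫ ω, iteratedFDeriv ℝ n F.f (F.point ω) (fun _ i => inner ℝ (F.φ i) u) ∂P := by
  have := hB.gaussian.isProbabilityMeasure
  set w : Fin F.m → ℝ := fun i => inner ℝ (F.φ i) u with hw
  -- The components orthogonal to `u`; given their values, `F` depends on `B(u)` only, along a line
  -- of direction `w`.
  let Z : Fin F.m → hilb B P T := fun i => F.φ i - w i • u
  let Zv : Ω → Fin F.m → ℝ := fun ω i => (Z i : Lp ℝ 2 P) ω
  have hZ : AEMeasurable Zv P := aemeasurable_vec Z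
  have hum := (Lp.aestronglyMeasurable (u : Lp ℝ 2 P)).aemeasurable
  have hindep : IndepFun Zv (u : Lp ℝ 2 P) P := indepFun_of_orthogonal hB Z u fun i => by
    rw [inner_sub_left, hilb_inner_smul_left, real_inner_self_eq_norm_sq, hu]
    simp only [hw]
    ring
  have hlaw : P.map (fun ω => (Zv ω, (u : Lp ℝ 2 P) ω)) = (P.map Zv).prod (gaussianReal 0 1) := by
    rw [(indepFun_iff_map_prod_eq_prod_map_map hZ hum).1 hindep, map_eq_gaussianReal hB hu]
  have := Measure.isProbabilityMeasure_map hZ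
  have hpt : ∀ᵐ ω ∂P, F.point ω = Zv ω + (u : Lp ℝ 2 P) ω • w := by
    have h : ∀ᵐ ω ∂P, ∀ i, Zv ω i = (F.φ i : Lp ℝ 2 P) ω - w i * (u : Lp ℝ 2 P) ω :=
      ae_all_iff.2 fun i => by
        filter_upwards [Lp.coeFn_sub (F.φ i : Lp ℝ 2 P) ((w i • u : hilb B P T) : Lp ℝ 2 P),
          Lp.coeFn_smul (w i) (u : Lp ℝ 2 P)] with ω h1 h2
        change ((F.φ i : Lp ℝ 2 P) - ((w i • u : hilb B P T) : Lp ℝ 2 P) : Lp ℝ 2 P) ω = _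
        rw [h1, Pi.sub_apply, Submodule.coe_smul, h2]
        rfl
    filter_upwards [h] with ω hω
    ext i
    simp [SmoothCyl.point, hω, mul_comm]
  choose C hC using F.bounded
  have hherm := integrable_hermiteEval
  have hfm : Continuous fun p : (Fin F.m → ℝ) × ℝ => F.f (p.1 + p.2 • w) * hermiteEval n p.2 :=
    (F.smooth.continuous.comp (by fun_prop)).mul ((continuous_hermiteEval n).comp continuous_snd)
  have hdm : Continuous fun p : (Fin F.m → ℝ) × ℝ =>
      iteratedFDeriv ℝ n F.f (p.1 + p.2 • w) (fun _ => w) := by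
    have h1 := F.smooth.continuous_iteratedFDeriv (m := n) (by exact_mod_cast le_top)
    have h2 := (ContinuousMultilinearMap.apply ℝ (fun _ : Fin n => Fin F.m → ℝ) ℝ
      (fun _ => w)).continuous.comp h1
    exact h2.comp (g := fun x => iteratedFDeriv ℝ n F.f x fun _ => w)
      (f := fun p : (Fin F.m → ℝ) × ℝ => p.1 + p.2 • w) (by fun_prop)
  have hi1 : Integrable (fun p : (Fin F.m → ℝ) × ℝ => F.f (p.1 + p.2 • w) * hermiteEval n p.2)
      ((P.map Zv).prod (gaussianReal 0 1)) := by
    refine ((hherm n).comp_snd (P.map Zv)).bdd_mul (c := C 0)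
      (F.smooth.continuous.comp (by fun_prop)).aestronglyMeasurable (.of_forall fun p => ?_)
    simpa using hC 0 (p.1 + p.2 • w)
  have hi2 : Integrable (fun p : (Fin F.m → ℝ) × ℝ =>
      iteratedFDeriv ℝ n F.f (p.1 + p.2 • w) (fun _ => w))
      ((P.map Zv).prod (gaussianReal 0 1)) :=
    .of_bound hdm.aestronglyMeasurable (C n * ‖w‖ ^ n)
      (.of_forall fun p => abs_iteratedFDeriv_le_of_bounded (hC n) _ _)
  calc ∫ ω, F.val ω * hermiteEval n ((u : Lp ℝ 2 P) ω) ∂P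
      = ∫ ω, F.f (Zv ω + (u : Lp ℝ 2 P) ω • w) * hermiteEval n ((u : Lp ℝ 2 P) ω) ∂P :=
        integral_congr_ae (hpt.mono fun ω hω => by simp only [SmoothCyl.val, hω])
    _ = ∫ p, F.f (p.1 + p.2 • w) * hermiteEval n p.2 ∂((P.map Zv).prod (gaussianReal 0 1)) := by
        rw [← hlaw, integral_map (hZ.prodMk hum) hfm.aestronglyMeasurable]
    _ = ∫ z, ∫ y, F.f (z + y • w) * hermiteEval n y ∂gaussianReal 0 1 ∂P.map Zv :=
        integral_prod _ hi1
    _ = ∫ z, ∫ y, iteratedFDeriv ℝ n F.f (z + y • w) (fun _ => w) ∂gaussianReal 0 1 ∂P.map Zv := by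
        congr 1
        ext z
        rw [← integral_iteratedDeriv_eq (contDiff_comp_line F.smooth z w)]
        · simp only [iteratedDeriv_comp_line F.smooth]
        · intro k j
          refine (hherm j).bdd_mul (c := C k * ‖w‖ ^ k)
            ((contDiff_comp_line F.smooth z w).continuous_iteratedDeriv k
              (by exact_mod_cast le_top)).aestronglyMeasurable (.of_forall fun y => ?_)
          rw [iteratedDeriv_comp_line F.smooth]
          exact abs_iteratedFDeriv_le_of_bounded (hC k) _ _
    _ = ∫ p, iteratedFDeriv ℝ n F.f (p.1 + p.2 • w) (fun _ => w)
          ∂((P.map Zv).prod (gaussianReal 0 1)) := (integral_prod _ hi2).symm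
    _ = ∫ ω, iteratedFDeriv ℝ n F.f (Zv ω + (u : Lp ℝ 2 P) ω • w) (fun _ => w) ∂P := by
        rw [← hlaw, integral_map (hZ.prodMk hum) hdm.aestronglyMeasurable]
    _ = ∫ ω, iteratedFDeriv ℝ n F.f (F.point ω) (fun _ => w) ∂P :=
        integral_congr_ae (hpt.mono fun ω hω => by simp only [hω])

/-! ### Parseval's equality and the Hermite coefficients of `sign` -/

/-- The squared distance from `x` to a partial sum is `‖x‖²` minus the partial sum in `hsum`.
Parseval's equality for the single vector `x` thus replaces completeness of the family. -/
theorem hasSum_smul_of_orthogonal {V : Type*} [NormedAddCommGroup V] [InnerProductSpace ℝ V]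
    {x : V} {g : ℕ → V} {b : ℕ → ℝ} (horth : ∀ j k, j ≠ k → inner ℝ (g j) (g k) = 0)
    (hb : ∀ k, b k * ‖g k‖ ^ 2 = inner ℝ x (g k))
    (hsum : HasSum (fun k => b k * inner ℝ x (g k)) (‖x‖ ^ 2)) :
    HasSum (fun k => b k • g k) x := by
  have key : ∀ s : Finset ℕ, ‖∑ k ∈ s, b k • g k - x‖ ^ 2 =
      ‖x‖ ^ 2 - ∑ k ∈ s, b k * inner ℝ x (g k) := by
    intro s
    have h1 : inner ℝ (∑ k ∈ s, b k • g k) x = ∑ k ∈ s, b k * inner ℝ x (g k) := by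
      rw [sum_inner]
      exact Finset.sum_congr rfl fun k _ => by rw [real_inner_smul_left, real_inner_comm]
    have h2 : ‖∑ k ∈ s, b k • g k‖ ^ 2 = ∑ k ∈ s, b k * inner ℝ x (g k) := by
      rw [← real_inner_self_eq_norm_sq, sum_inner]
      refine Finset.sum_congr rfl fun k hk => ?_
      rw [inner_sum, Finset.sum_eq_single k]
      · rw [real_inner_smul_left, real_inner_smul_right, real_inner_self_eq_norm_sq, hb]
      · intro j _ hj
        rw [real_inner_smul_left, real_inner_smul_right, horth k j hj.symm]
        simp
      · exact fun h => absurd hk h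
    rw [norm_sub_sq_real, h1, h2]
    ring
  rw [HasSum, SummationFilter.unconditional_filter, tendsto_iff_norm_sub_tendsto_zero]
  have h : Filter.Tendsto (fun s : Finset ℕ => ‖∑ k ∈ s, b k • g k - x‖ ^ 2) Filter.atTop
      (nhds 0) := by
    simp_rw [key]
    have h := hsum
    rw [HasSum, SummationFilter.unconditional_filter] at h
    have h' : Filter.Tendsto (fun s : Finset ℕ => ‖x‖ ^ 2 - ∑ k ∈ s, b k * inner ℝ x (g k))
      Filter.atTop (nhds (‖x‖ ^ 2 - ‖x‖ ^ 2)) := h.const_sub _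
    rwa [sub_self] at h'
  simpa using h.sqrt

theorem measurable_sign : Measurable Real.sign := by
  unfold Real.sign
  exact Measurable.ite measurableSet_Iio measurable_const
    (Measurable.ite measurableSet_Ioi measurable_const measurable_const)

theorem abs_sign_le_one (x : ℝ) : |Real.sign x| ≤ 1 := by
  rcases Real.sign_apply_eq x with h | h | h <;> simp [h]

theorem integral_sign_sq_gaussianReal : ∫ x, Real.sign x ^ 2 ∂gaussianReal 0 1 = 1 := by
  have := nullSingletonClass_gaussianReal (μ := 0) (v := 1) one_ne_zero
  have h : ∀ᵐ x ∂gaussianReal 0 1, Real.sign x ^ 2 = 1 := by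
    filter_upwards [Measure.ae_ne (gaussianReal 0 1) 0] with x hx
    rcases hx.lt_or_gt with h | h
    · simp [Real.sign_of_neg h]
    · simp [Real.sign_of_pos h]
  rw [integral_congr_ae h]
  simp

theorem factorial_two_mul_eq (k : ℕ) :
    ((2 * k).factorial : ℝ) = 2 ^ k * k.factorial * (2 * k - 1).doubleFactorial := by
  -- At `k = 0` the truncated `2 * k - 1` is `0`, whose double factorial is `1`, as wanted.
  rcases k with _ | k
  · simp
  · have h := Nat.factorial_eq_mul_doubleFactorial (2 * k + 1)
    rw [show 2 * k + 1 + 1 = 2 * (k + 1) by ring, Nat.doubleFactorial_two_mul] at h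
    rw [h, show 2 * (k + 1) - 1 = 2 * k + 1 by omega]
    push_cast
    ring

theorem centralBinom_div_four_pow (k : ℕ) :
    (k.centralBinom : ℝ) / 4 ^ k = (2 * k - 1).doubleFactorial / (k.factorial * 2 ^ k) := by
  have h1 := factorial_two_mul_eq k
  have h2 : ((2 * k).factorial : ℝ) = k.centralBinom * k.factorial * k.factorial := by
    have h := Nat.choose_mul_factorial_mul_factorial (show k ≤ 2 * k by omega)
    rw [show 2 * k - k = k by omega] at h
    rw [← h, Nat.centralBinom]
    push_cast
    ring
  have h3 : (k.factorial : ℝ) ≠ 0 := by positivity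
  have h4 : (4 : ℝ) ^ k = 2 ^ k * 2 ^ k := by rw [← mul_pow]; norm_num
  rw [h4, div_eq_div_iff (by positivity) (by positivity)]
  refine mul_right_cancel₀ h3 ?_
  linear_combination (-(2 : ℝ) ^ k) * (h2 - h1)

/-- The coefficient of the `(2k+1)`-st Hermite polynomial in the expansion of `sign`. -/
noncomputable def signCoeff (k : ℕ) : ℝ :=
  2 * (-1) ^ k / ((2 * k + 1) * √(2 * Real.pi) * k.factorial * 2 ^ k)

theorem integral_sign_mul_hermiteEval_odd (k : ℕ) :
    ∫ x, Real.sign x * hermiteEval (2 * k + 1) x ∂gaussianReal 0 1 =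
      2 * ((-1) ^ k * ((2 * k - 1).doubleFactorial : ℝ)) / √(2 * Real.pi) := by
  rw [integral_sign_mul_hermiteEval, hermiteEval_even_zero]

/-- With `E[He_{2k+1}(N)²] = (2k+1)!`, this identifies `signCoeff k` as the Fourier coefficient of
`sign`. -/
theorem signCoeff_mul_factorial (k : ℕ) :
    signCoeff k * (2 * k + 1).factorial =
      2 * ((-1) ^ k * ((2 * k - 1).doubleFactorial : ℝ)) / √(2 * Real.pi) := by
  have h1 := factorial_two_mul_eq k
  have : (0 : ℝ) < √(2 * Real.pi) := by positivity
  rw [signCoeff, Nat.factorial_succ]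
  push_cast
  rw [h1]
  field_simp

/-- Parseval's equality for `sign`: the signs `(-1)^k` cancel and `2/π` times the arcsine series is
left. -/
theorem hasSum_signCoeff_mul :
    HasSum (fun k : ℕ => signCoeff k *
      (2 * ((-1) ^ k * ((2 * k - 1).doubleFactorial : ℝ)) / √(2 * Real.pi))) 1 := by
  have h := hasSum_centralBinom_div.mul_left (2 / Real.pi)
  rw [show 2 / Real.pi * (Real.pi / 2) = 1 by field_simp] at h
  refine h.congr_fun ?_
  intro k
  have hs : √(2 * Real.pi) * √(2 * Real.pi) = 2 * Real.pi := Real.mul_self_sqrt (by positivity)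
  have hm : ((-1 : ℝ) ^ k) * (-1) ^ k = 1 := by rw [← mul_pow]; norm_num
  rw [centralBinom_div_four_pow, signCoeff, div_mul_div_comm]
  have e : ((2 * k + 1) * √(2 * Real.pi) * k.factorial * 2 ^ k) * √(2 * Real.pi) =
      (2 * k + 1) * k.factorial * 2 ^ k * (2 * Real.pi) := by
    linear_combination ((2 * k + 1) * k.factorial * 2 ^ k : ℝ) * hs
  have e2 : 2 * (-1 : ℝ) ^ k * (2 * ((-1) ^ k * ((2 * k - 1).doubleFactorial : ℝ))) =
      4 * (2 * k - 1).doubleFactorial := by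
    linear_combination 4 * ((2 * k - 1).doubleFactorial : ℝ) * hm
  rw [e, e2]
  field_simp
  ring


/-! ### Malliavin derivatives and Hermite variables -/

/-- The characteristic function of a centred Gaussian variable is real. -/
theorem integral_sin_of_mem_hilb (hB : IsFBM H B P) {X : Lp ℝ 2 P} (hX : X ∈ hilb B P T) :
    ∫ ω, Real.sin (X ω) ∂P = 0 := by
  have := hB.gaussian.isProbabilityMeasure
  have hi : Integrable (fun ω => Complex.exp (X ω * Complex.I)) P :=
    .of_bound (Continuous.comp_aestronglyMeasurable
      (g := fun y : ℝ => Complex.exp (y * Complex.I)) (by fun_prop) (Lp.aestronglyMeasurable X)) 1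
      (.of_forall fun ω => (Complex.norm_exp_ofReal_mul_I _).le)
  have h := congrArg Complex.im (integral_exp_of_mem_hilb hB hX)
  have him := integral_im hi
  rw [show (-(‖X‖ ^ 2 : ℝ) / 2 : ℂ) = ((-(‖X‖ ^ 2) / 2 : ℝ) : ℂ) by push_cast; rfl,
    Complex.exp_ofReal_im] at h
  rw [← h, ← RCLike.im_eq_complex_im, ← him]
  exact integral_congr_ae (.of_forall fun ω => (Complex.exp_ofReal_mul_I_im _).symm)

/-- Expanding the multilinear map in the basis, `⟨DⁿF, h^{⊗n}⟩` is the `n`-th derivative of `f` in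
the direction `(⟨φᵢ, h⟩)ᵢ`. -/
theorem inner_malliavin_tensor [IsProbabilityMeasure P] (F : SmoothCyl B P T) (n : ℕ) (ω : Ω)
    (h : hilb B P T) :
    inner ℝ (F.malliavin n ω) (tensor fun _ : Fin n => h) =
      iteratedFDeriv ℝ n F.f (F.point ω) fun _ i => inner ℝ (F.φ i) h := by
  have hv : (fun i => inner ℝ (F.φ i) h) =
      ∑ i, (inner ℝ (F.φ i) h : ℝ) • (Pi.single i 1 : Fin F.m → ℝ) := by
    ext j
    simp [Finset.sum_apply, Pi.single_apply]
  rw [hv, ContinuousMultilinearMap.map_sum, SmoothCyl.malliavin, sum_inner]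
  refine Finset.sum_congr rfl fun i _ => ?_
  rw [ContinuousMultilinearMap.map_smul_univ, smul_eq_mul, mul_comm]
  refine (real_inner_smul_left (tensorLp P fun j => (F.φ (i j) : Lp ℝ 2 P))
    (tensorLp P fun _ => (h : Lp ℝ 2 P)) _).trans ?_
  rw [inner_tensorLp]
  rfl

section Hermite

variable {u : hilb B P T}

theorem integral_comp_unit (hB : IsFBM H B P) (hu : ‖u‖ = 1) {f : ℝ → ℝ} (hf : Measurable f) :
    ∫ ω, f ((u : Lp ℝ 2 P) ω) ∂P = ∫ x, f x ∂gaussianReal 0 1 := by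
  rw [← map_eq_gaussianReal hB hu,
    integral_map (Lp.aestronglyMeasurable (u : Lp ℝ 2 P)).aemeasurable hf.aestronglyMeasurable]

theorem memLp_hermiteEval (hB : IsFBM H B P) (hu : ‖u‖ = 1) (n : ℕ) :
    MemLp (fun ω => hermiteEval n ((u : Lp ℝ 2 P) ω)) 2 P := by
  have hum := Lp.aestronglyMeasurable (u : Lp ℝ 2 P)
  have hm := (continuous_hermiteEval n).comp_aestronglyMeasurable hum
  rw [memLp_two_iff_integrable_sq hm]
  have h := integrable_polynomial_mul_hermiteEval
    ((Polynomial.hermite n).map (Int.castRingHom ℝ)) n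
  rw [← map_eq_gaussianReal hB hu] at h
  have h2 := h.comp_aemeasurable hum.aemeasurable
  refine h2.congr (.of_forall fun ω => ?_)
  simp [← hermiteEval_eq_eval, pow_two]

/-- The random variable `Heₙ(B(u))` for a unit vector `u` of the Gaussian space. -/
noncomputable def hermiteLp (hB : IsFBM H B P) (hu : ‖u‖ = 1) (n : ℕ) : Lp ℝ 2 P :=
  (memLp_hermiteEval hB hu n).toLp _

theorem inner_hermiteLp (hB : IsFBM H B P) (hu : ‖u‖ = 1) (m n : ℕ) :
    inner ℝ (hermiteLp hB hu m) (hermiteLp hB hu n) =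
      ∫ x, hermiteEval m x * hermiteEval n x ∂gaussianReal 0 1 := by
  rw [← integral_comp_unit (f := fun x => hermiteEval m x * hermiteEval n x) hB hu
    ((continuous_hermiteEval m).mul (continuous_hermiteEval n)).measurable, L2.inner_def]
  refine integral_congr_ae ?_
  filter_upwards [(memLp_hermiteEval hB hu m).coeFn_toLp,
    (memLp_hermiteEval hB hu n).coeFn_toLp] with ω h1 h2
  simp only [hermiteLp, h1, h2]
  simp [mul_comm]

end Hermite

/-! ### The integrals of `1_{[0,t]}^{⊗n}` and the expansion of `sign(B_t)` -/

namespace IsFBM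

variable {t : ℝ≥0}

theorem norm_ind (hB : IsFBM H B P) (hH : 0 < H) (htT : t ≤ T) :
    ‖hB.ind htT‖ = (t : ℝ) ^ H := by
  have h := hB.inner_ind htT htT
  rw [real_inner_self_eq_norm_sq, cov] at h
  simp only [sub_self, abs_zero, Real.zero_rpow (show 2 * H ≠ 0 by positivity), sub_zero] at h
  rw [← sq_eq_sq₀ (norm_nonneg _) (by positivity), h, mul_comm 2 H, Real.rpow_mul (by positivity)]
  norm_num

/-- The normalised indicator `1_{[0,t]} / t^H`. -/
noncomputable def unit (hB : IsFBM H B P) (htT : t ≤ T) : hilb B P T :=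
  ((t : ℝ) ^ H)⁻¹ • hB.ind htT

theorem norm_unit (hB : IsFBM H B P) (hH : 0 < H) (ht : 0 < t) (htT : t ≤ T) :
    ‖hB.unit htT‖ = 1 := by
  have : (0 : ℝ) < (t : ℝ) ^ H := by positivity
  rw [unit, norm_smul, hB.norm_ind hH htT, norm_inv, Real.norm_of_nonneg this.le,
    inv_mul_cancel₀ this.ne']

theorem coeFn_unit (hB : IsFBM H B P) (htT : t ≤ T) :
    (hB.unit htT : Lp ℝ 2 P) =ᵐ[P] fun ω => ((t : ℝ) ^ H)⁻¹ * B t ω := by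
  filter_upwards [Lp.coeFn_smul ((t : ℝ) ^ H)⁻¹ (hB.ind htT : Lp ℝ 2 P),
    (hB.memLp t).coeFn_toLp] with ω h1 h2
  refine h1.trans ?_
  rw [Pi.smul_apply, smul_eq_mul]
  exact congrArg _ h2

/-- `Iₙ(1_{[0,t]}^{⊗ n}) = t^{nH} Heₙ(B_t / t^H)`. -/
theorem isMultipleIntegral_hermite [IsProbabilityMeasure P] (hB : IsFBM H B P) (hH : 0 < H)
    (ht : 0 < t) (htT : t ≤ T) (n : ℕ) :
    IsMultipleIntegral B P T n (tensor fun _ => hB.ind htT)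
      (((t : ℝ) ^ H) ^ n • hermiteLp hB (hB.norm_unit hH ht htT) n) := by
  have hu := hB.norm_unit hH ht htT
  have hσ : (0 : ℝ) < (t : ℝ) ^ H := by positivity
  have hG : (((t : ℝ) ^ H) ^ n • hermiteLp hB hu n : Lp ℝ 2 P) =ᵐ[P]
      fun ω => ((t : ℝ) ^ H) ^ n * hermiteEval n ((hB.unit htT : Lp ℝ 2 P) ω) := by
    filter_upwards [Lp.coeFn_smul (((t : ℝ) ^ H) ^ n) (hermiteLp hB hu n),
      (memLp_hermiteEval hB hu n).coeFn_toLp] with ω h1 h2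
    rw [h1, Pi.smul_apply, smul_eq_mul, hermiteLp, h2]
  -- A representative written with `B t` itself, which is measurable for `sigmaAlg B T`.
  refine ⟨⟨fun ω => ((t : ℝ) ^ H) ^ n * hermiteEval n (((t : ℝ) ^ H)⁻¹ * B t ω), ?_, ?_⟩,
    fun F => ?_⟩
  · have hBt : Measurable[sigmaAlg B T] (B t) := by
      refine (comap_measurable (B t)).mono ?_ le_rfl
      exact le_iSup (fun s : Set.Iic T => MeasurableSpace.comap (B s) inferInstance) ⟨t, htT⟩
    have hc : Measurable fun x : ℝ =>
        ((t : ℝ) ^ H) ^ n * hermiteEval n (((t : ℝ) ^ H)⁻¹ * x) :=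
      (continuous_const.mul ((continuous_hermiteEval n).comp (by fun_prop))).measurable
    exact (hc.comp hBt).stronglyMeasurable
  · filter_upwards [hG, hB.coeFn_unit htT] with ω h1 h2
    rw [h1, h2]
  · have hind : hB.ind htT = (t : ℝ) ^ H • hB.unit htT := by
      rw [unit, smul_smul, mul_inv_cancel₀ hσ.ne', one_smul]
    calc ∫ ω, F.val ω * (((t : ℝ) ^ H) ^ n • hermiteLp hB hu n : Lp ℝ 2 P) ω ∂P
        = ∫ ω, ((t : ℝ) ^ H) ^ n *
            (F.val ω * hermiteEval n ((hB.unit htT : Lp ℝ 2 P) ω)) ∂P :=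
          integral_congr_ae (hG.mono fun ω h => by simp only [h]; ring)
      _ = ∫ ω, ((t : ℝ) ^ H) ^ n * iteratedFDeriv ℝ n F.f (F.point ω)
            (fun _ i => inner ℝ (F.φ i) (hB.unit htT)) ∂P := by
          rw [integral_const_mul, integral_val_mul_hermiteEval hB F hu, integral_const_mul]
      _ = _ := by
          congr 1
          ext ω
          rw [inner_malliavin_tensor, hind]
          simp only [hilb_inner_smul_right]
          -- Homogeneity of degree `n` accounts for the factor `t^{nH}`.
          have := (iteratedFDeriv ℝ n F.f (F.point ω)).map_smul_univ
            (fun _ => (t : ℝ) ^ H) (fun _ i => inner ℝ (F.φ i) (hB.unit htT))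
          simp only [Finset.prod_const, Finset.card_univ, Fintype.card_fin, smul_eq_mul] at this
          exact this.symm

theorem multipleIntegral_eq [IsProbabilityMeasure P] (hB : IsFBM H B P) (hH : 0 < H)
    (ht : 0 < t) (htT : t ≤ T) (n : ℕ) :
    multipleIntegral B P T n (tensor fun _ => hB.ind htT) =
      ((t : ℝ) ^ H) ^ n • hermiteLp hB (hB.norm_unit hH ht htT) n := by
  have h := hB.isMultipleIntegral_hermite hH ht htT n
  have hex : ∃ G, IsMultipleIntegral B P T n (tensor fun _ => hB.ind htT) G := ⟨_, h⟩
  rw [multipleIntegral, dif_pos hex]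
  exact hex.choose_spec.unique hB h

theorem sign_ae_eq [IsProbabilityMeasure P] (hB : IsFBM H B P) (ht : 0 < t) (htT : t ≤ T) :
    hB.sign t =ᵐ[P] fun ω => Real.sign ((hB.unit htT : Lp ℝ 2 P) ω) := by
  have hσ : (0 : ℝ) < ((t : ℝ) ^ H)⁻¹ := by positivity
  filter_upwards [(hB.memLp_sign t).coeFn_toLp, hB.coeFn_unit htT] with ω h1 h2
  rw [sign, h1, h2]
  rcases lt_trichotomy (B t ω) 0 with h | h | h
  · rw [Real.sign_of_neg h, Real.sign_of_neg (mul_neg_of_pos_of_neg hσ h)]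
  · simp [h]
  · rw [Real.sign_of_pos h, Real.sign_of_pos (mul_pos hσ h)]

theorem norm_sign_sq [IsProbabilityMeasure P] (hB : IsFBM H B P) (hH : 0 < H) (ht : 0 < t) :
    ‖hB.sign t‖ ^ 2 = 1 := by
  rw [norm_sq_eq_integral, ← integral_sign_sq_gaussianReal,
    ← integral_comp_unit hB (hB.norm_unit hH ht le_rfl) (measurable_sign.pow_const 2)]
  exact integral_congr_ae ((hB.sign_ae_eq ht le_rfl).mono fun ω h => by simp only [h])

theorem inner_sign_hermiteLp [IsProbabilityMeasure P] (hB : IsFBM H B P) (hH : 0 < H)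
    (ht : 0 < t) (htT : t ≤ T) (n : ℕ) :
    inner ℝ (hB.sign t) (hermiteLp hB (hB.norm_unit hH ht htT) n) =
      ∫ x, Real.sign x * hermiteEval n x ∂gaussianReal 0 1 := by
  have hu := hB.norm_unit hH ht htT
  rw [← integral_comp_unit (f := fun x => Real.sign x * hermiteEval n x) hB hu
    (measurable_sign.mul (continuous_hermiteEval n).measurable), L2.inner_def]
  refine integral_congr_ae ?_
  filter_upwards [(memLp_hermiteEval hB hu n).coeFn_toLp, hB.sign_ae_eq ht htT] with ω h1 h2
  simp only [hermiteLp, h1, h2]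
  simp [mul_comm]

theorem coeff_mul_pow (H : ℝ) (ht : 0 < t) (k : ℕ) :
    coeff H t k * ((t : ℝ) ^ H) ^ (2 * k + 1) = signCoeff k := by
  have h : (t : ℝ) ^ ((2 * k + 1) * H) = ((t : ℝ) ^ H) ^ (2 * k + 1) := by
    rw [mul_comm, Real.rpow_mul (by positivity), ← Real.rpow_natCast]
    push_cast
    rfl
  have hσ : (0 : ℝ) < (t : ℝ) ^ H := by positivity
  rw [coeff, h, signCoeff]
  field_simp

theorem hasSum_sign [IsProbabilityMeasure P] (hB : IsFBM H B P) (hH : 0 < H) (ht : 0 < t)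
    (htT : t ≤ T) :
    HasSum (fun k : ℕ => coeff H t k •
      multipleIntegral B P T (2 * k + 1) (tensor fun _ => hB.ind htT)) (hB.sign t) := by
  simp_rw [hB.multipleIntegral_eq hH ht htT, smul_smul, coeff_mul_pow H ht]
  refine hasSum_smul_of_orthogonal (fun j k hjk => ?_) (fun k => ?_) ?_
  · rw [inner_hermiteLp, integral_hermiteEval_mul (by omega)]
  · rw [← real_inner_self_eq_norm_sq, inner_hermiteLp, integral_hermiteEval_mul_self,
      hB.inner_sign_hermiteLp hH ht htT, integral_sign_mul_hermiteEval_odd,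
      signCoeff_mul_factorial]
  · simp_rw [hB.inner_sign_hermiteLp hH ht htT, integral_sign_mul_hermiteEval_odd,
      hB.norm_sign_sq hH ht]
    exact hasSum_signCoeff_mul

/-! ### Orthogonality to the even chaoses -/

/-- An element of a chaos of even order is orthogonal to the odd trigonometric functions
of `B_t`. -/
theorem integral_sin_mul_of_mem_chaos [IsProbabilityMeasure P] (hB : IsFBM H B P)
    (htT : t ≤ T) {n : ℕ} (hn : Even n) {G : Lp ℝ 2 P} (hG : G ∈ chaos B P T n) (c : ℝ) :
    ∫ ω, Real.sin (c * B t ω) * G ω ∂P = 0 := by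
  obtain ⟨g, -, hF⟩ := hG
  obtain ⟨k, rfl⟩ := hn.two_dvd
  let L : StrongDual ℝ (Fin 1 → ℝ) := c • ContinuousLinearMap.proj 0
  let F : SmoothCyl B P T := ridgeCyl (fun _ : Fin 1 => hB.ind htT) L Real.sin Real.contDiff_sin
    Real.abs_iteratedDeriv_sin_le_one
  have hval : ∀ ω, F.val ω = Real.sin (c * (hB.ind htT : Lp ℝ 2 P) ω) := fun ω => rfl
  -- The derivative of order `2k` of `sin` is `(-1)^k sin`, so the only randomness in `D^{2k}F` is
  -- the scalar factor `F`.
  have hmal : ∀ ω, F.malliavin (2 * k) ω = F.val ω • ∑ i : Fin (2 * k) → Fin 1,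
      ((∏ j, L (Pi.single (i j) 1)) * (-1) ^ k) •
        tensor fun j => F.φ (i j) := by
    intro ω
    rw [SmoothCyl.malliavin, Finset.smul_sum]
    refine Finset.sum_congr rfl fun i _ => ?_
    rw [smul_smul]
    congr 1
    refine (iteratedFDeriv_comp_dual_apply Real.contDiff_sin L (2 * k) _ _).trans ?_
    rw [Real.iteratedDeriv_even_sin]
    simp only [Pi.mul_apply, Pi.pow_apply, Pi.neg_apply, Pi.one_apply]
    have hcomm : ∀ a b c : ℝ, a * (b * c) = c * (a * b) := fun a b c => by ring
    exact hcomm _ _ _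
  have hsin : ∫ ω, F.val ω ∂P = 0 := by
    rw [← integral_sin_of_mem_hilb hB (c • hB.ind htT).2]
    refine integral_congr_ae ?_
    filter_upwards [Lp.coeFn_smul c (hB.ind htT : Lp ℝ 2 P)] with ω h
    rw [hval]
    exact congrArg Real.sin h.symm
  calc ∫ ω, Real.sin (c * B t ω) * G ω ∂P = ∫ ω, F.val ω * G ω ∂P := by
        refine integral_congr_ae ?_
        filter_upwards [(hB.memLp t).coeFn_toLp] with ω h
        simp only [hval]
        rw [show (hB.ind htT : Lp ℝ 2 P) ω = B t ω from h]
    _ = ∫ ω, F.val ω * inner ℝ (∑ i : Fin (2 * k) → Fin 1,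
          ((∏ j, L (Pi.single (i j) 1)) * (-1) ^ k) • tensor fun j => F.φ (i j)) g ∂P := by
        rw [hF F]
        congr 1
        ext ω
        rw [hmal]
        exact real_inner_smul_left (F := tensorPow B P T (2 * k)) _ _ _
    _ = 0 := by rw [integral_mul_const, hsin, zero_mul]

theorem inner_sign_of_mem_chaos [IsProbabilityMeasure P] (hB : IsFBM H B P)
    (htT : t ≤ T) {n : ℕ} (hn : Even n) {G : Lp ℝ 2 P} (hG : G ∈ chaos B P T n) :
    inner ℝ (hB.sign t) G = 0 := by
  have hint : Integrable G P := (Lp.memLp G).integrable (by norm_num)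
  have hL : ∀ (L : StrongDual ℝ ℝ) x, L x = L 1 * x := fun L x => by
    rw [mul_comm, ← smul_eq_mul, ← map_smul, smul_eq_mul, mul_one]
  have h0 : ∀ L : StrongDual ℝ ℝ, ∫ ω, Real.sin (L (B t ω)) * G ω ∂P = 0 := fun L => by
    simp_rw [hL L (B t _)]
    exact hB.integral_sin_mul_of_mem_chaos htT hn hG (L 1)
  -- Compares `B_t` with `-B_t` under the weight `G`: cosines agree by parity, and both sine
  -- integrals vanish by `h0`. Oddness of `sign` then gives `E[sign(B_t) G] = -E[sign(B_t) G]`.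
  have key := integral_comp_mul_eq_of_cos_sin (hB.measurable t) (hB.measurable t).neg hint hint
    (fun L => by simp) (fun L => by simp [integral_neg, h0 L]) measurable_sign abs_sign_le_one
  simp only [Pi.neg_apply, Real.sign_neg, neg_mul, integral_neg] at key
  have h1 : inner ℝ (hB.sign t) G = ∫ ω, Real.sign (B t ω) * G ω ∂P := by
    rw [L2.inner_def]
    refine integral_congr_ae ?_
    filter_upwards [(hB.memLp_sign t).coeFn_toLp] with ω h
    simp only [sign, h]
    simp [mul_comm]
  rw [h1]
  linarith

end IsFBM

end FBM

/-- Chaos expansion of `sign(B_t)`: the integrals `Iₙ(1_{[0,t]}^{⊗ n})` are well defined,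
`sign(B_t) = ∑ₖ b_{2k+1} I_{2k+1}(1_{[0,t]}^{⊗ (2k+1)})` in `L²`, and `sign(B_t)` has no component
in the Wiener chaoses of even order. -/
theorem mainTheorem6 {Ω : Type*} [MeasurableSpace Ω] (P : Measure Ω) [IsProbabilityMeasure P]
    (H : ℝ) (hH0 : 0 < H) (hH1 : H < 1) (B : ℝ≥0 → Ω → ℝ) (hB : FBM.IsFBM H B P)
    (t T : ℝ≥0) (ht : 0 < t) (htT : t ≤ T) :
    (∀ n : ℕ, ∃! G : Lp ℝ 2 P,
      FBM.IsMultipleIntegral B P T n (FBM.tensor fun _ => hB.ind htT) G) ∧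
    HasSum (fun k : ℕ => FBM.coeff H t k •
      FBM.multipleIntegral B P T (2 * k + 1) (FBM.tensor fun _ => hB.ind htT)) (hB.sign t) ∧
    (∀ n : ℕ, Even n → ∀ G ∈ FBM.chaos B P T n, inner ℝ (hB.sign t) G = 0) := by
  exact ⟨fun n => ⟨_, hB.isMultipleIntegral_hermite hH0 ht htT n,
      fun G hG => hG.unique hB (hB.isMultipleIntegral_hermite hH0 ht htT n)⟩,
    hB.hasSum_sign hH0 ht htT, fun n hn G hG => hB.inner_sign_of_mem_chaos htT hn hG⟩
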